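/- Let $f(x)=\dfrac{e^x}{(1+e^x)^2}$, $x\in\mathbb R$, be the density of the logistic measure $\ell$, let $N\ge 0$, and let $F(x)=\prod_{i=1}^{N+1}f(x_i)=e^{\psi(x)}$ be the density of the product measure $\ell^{N+1}$ on $\mathbb R^{N+1}$. For an open set $A\subseteq\mathbb R^{N+1}$ with $C^2$ boundary and outer unit normal $\nu$, let $\mathcal H$ be the mean curvature of $\partial A$ with respect to $\nu$, $K^2$ the sum of the squared principal curvatures, $da$ the element of area and $D_{\partial A}$ the tangential gradient. The set $A$ is called stationary (for $\ell^{N+1}$) if $N\mathcal H-\langle D\psi,\nu\rangle$ is constant on $\partial A$, and stable if it is stationary and, for every $u\in C^\infty_0(\partial A)$ with $\int_{\partial A}uF\,da=0$, $$\int_{\partial A}F\big(|D_{\partial A}u|^2-K^2u^2\big)\,da+\int_{\partial A}F\,u^2\,\langle D^2\psi\,\nu,\nu\rangle\,da\ \ge 0 .$$ For a unit vector $v\in\mathbb R^{N+1}$ and $t\in\mathbb R$ put $H^{N+1}_{v,t}=\{x\in\mathbb R^{N+1}:\langle x,v\rangle<t\}$. This half-space is called a coordinate half-space if $v$ has exactly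 one non-zero component (for instance $\{x_{N+1}<t\}$). Let $\mathcal V$ be the set of unit vectors of $\mathbb R^{N+1}$ that have exactly two non-zero components, these two having equal absolute value. Theorem. 1. A coordinate half-space $H^{N+1}_{v,t}$ is stable for $\ell^{N+1}$ if $|t|\ge 2\log(2+\sqrt3)$. 2. A non-coordinate half-space $H^{N+1}_{v,t}$ is stable for $\ell^{N+1}$ if and only if $N+1=2$, $t=0$ and $v\in\mathcal V$ (so that its boundary is a bisector line of the coordinate axes of the plane). -/

import Mathlib

open scoped InnerProductSpace ContDiff MeasureTheory

noncomputable section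

namespace HalfSpaceStability

/-- The Euclidean space of dimension `d`. -/
abbrev Euc (d : ℕ) : Type := EuclideanSpace ℝ (Fin d)

/-! ### Geometry of the boundary of an open set -/

/-- The signed distance to the boundary of `A`: negative in the interior of `A`, positive outside
the closure of `A`. -/
def sdist {d : ℕ} (A : Set (Euc d)) (x : Euc d) : ℝ :=
  Metric.infDist x A - Metric.infDist x Aᶜ

/-- `A` is an open set with `C²` boundary. For an open set this is equivalent to the signed
distance being of class `C²` near each boundary point: it is then a local defining function
(`A = {sdist A < 0}`) with gradient of norm one. -/
def IsOpenC2 {d : ℕ} (A : Set (Euc d)) : Prop :=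
  IsOpen A ∧ ∀ p ∈ frontier A, ContDiffAt ℝ 2 (sdist A) p

/-- The outer unit normal of `A` at boundary points (extended to a neighbourhood of the boundary
as the gradient of the signed distance). -/
def normal {d : ℕ} (A : Set (Euc d)) (x : Euc d) : Euc d := gradient (sdist A) x

/-- The derivative of the normal. At a boundary point it is the differential of the Gauss map on
the tangent space, and it vanishes on the normal direction. Its eigenvalues on the tangent space
are, up to a common sign, the principal curvatures. -/
def shape {d : ℕ} (A : Set (Euc d)) (x : Euc d) : Euc d →L[ℝ] Euc d := fderiv ℝ (normal A) x

/-- The sum of the principal curvatures of the boundary with respect to the normal `normal A`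
(that is, `d - 1` times the mean curvature). -/
def sumCurv {d : ℕ} (A : Set (Euc d)) (x : Euc d) : ℝ :=
  -LinearMap.trace ℝ (Euc d) (shape A x).toLinearMap

/-- The sum of the squared principal curvatures. -/
def sumSqCurv {d : ℕ} (A : Set (Euc d)) (x : Euc d) : ℝ :=
  LinearMap.trace ℝ (Euc d) ((shape A x).comp (shape A x)).toLinearMap

/-- The tangential gradient along the boundary of `A`. -/
def tanGradient {d : ℕ} (A : Set (Euc d)) (u : Euc d → ℝ) (x : Euc d) : Euc d :=
  gradient u x - ⟪gradient u x, normal A x⟫_ℝ • normal A x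

/-- The element of area of the boundary of a set in dimension `N + 1`. -/
def area {N : ℕ} (A : Set (Euc (N + 1))) : MeasureTheory.Measure (Euc (N + 1)) :=
  (μHE[N] : MeasureTheory.Measure (Euc (N + 1))).restrict (frontier A)

/-! ### Stationary and stable sets for the measure with density `f = exp ψ` -/

/-- The generalized mean curvature of the boundary of `A`, with `ψ = log f`. -/
def genMeanCurv {N : ℕ} (f : Euc (N + 1) → ℝ) (A : Set (Euc (N + 1))) (x : Euc (N + 1)) : ℝ :=
  sumCurv A x - ⟪gradient (fun y => Real.log (f y)) x, normal A x⟫_ℝ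

/-- `A` is stationary: the generalized mean curvature is constant on the boundary. -/
def IsStationary {N : ℕ} (f : Euc (N + 1) → ℝ) (A : Set (Euc (N + 1))) : Prop :=
  IsOpenC2 A ∧ ∃ c : ℝ, ∀ x ∈ frontier A, genMeanCurv f A x = c

/-- The quadratic form of the second variation, with `ψ = log f`. -/
def secondVariation {N : ℕ} (f : Euc (N + 1) → ℝ) (A : Set (Euc (N + 1)))
    (u : Euc (N + 1) → ℝ) : ℝ :=
  (∫ x, f x * (‖tanGradient A u x‖ ^ 2 - sumSqCurv A x * u x ^ 2) ∂(area A)) +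
    ∫ x, f x * u x ^ 2 *
      ⟪fderiv ℝ (gradient (fun y => Real.log (f y))) x (normal A x), normal A x⟫_ℝ ∂(area A)

/-- `A` is stable: it is stationary and the second variation is nonnegative on the smooth compactly
supported functions on the boundary with mean zero. Such functions are given as restrictions to
the boundary of smooth compactly supported functions on the whole space. -/
def IsStable {N : ℕ} (f : Euc (N + 1) → ℝ) (A : Set (Euc (N + 1))) : Prop :=
  IsStationary f A ∧
    ∀ u : Euc (N + 1) → ℝ, ContDiff ℝ ∞ u → HasCompactSupport u →
      ∫ x, u x * f x ∂(area A) = 0 → 0 ≤ secondVariation f A u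

/-! ### The logistic measure and half-spaces -/

/-- The density of the logistic measure on the line. -/
def logisticDensity (x : ℝ) : ℝ := Real.exp x / (1 + Real.exp x) ^ 2

/-- The density of the `d`-fold product of the logistic measure. -/
def logisticProdDensity (d : ℕ) (x : Euc d) : ℝ := ∏ i, logisticDensity (x i)

/-- The half-space `{x : ⟨x, v⟩ < t}`. -/
def halfSpace {d : ℕ} (v : Euc d) (t : ℝ) : Set (Euc d) := {x | ⟪x, v⟫_ℝ < t}

/-- For a unit vector `v`: exactly one component is non-null, that is, half-spaces with normal `v`
are coordinate half-spaces. -/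
def IsCoordinate {d : ℕ} (v : Euc d) : Prop := ∃ i, ∀ k, k ≠ i → v k = 0

/-- The unit vectors with exactly two non-null components, equal in absolute value. -/
def bisectorVectors (d : ℕ) : Set (Euc d) :=
  {v | ‖v‖ = 1 ∧ ∃ i j, i ≠ j ∧ (∀ k, k ≠ i → k ≠ j → v k = 0) ∧ |v i| = |v j| ∧ |v i| ≠ 0}

end HalfSpaceStability

end

/-!
On the hyperplane `{⟪x, v⟫ = t}` the curvature terms vanish, and with `s = -(log f)'` stationarity
says that `∑ vᵢ s(xᵢ)` is constant there. Differentiating along the hyperplane, in the direction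
`vⱼ eᵢ - vᵢ eⱼ` with `vᵢ, vⱼ ≠ 0`, gives `f(xᵢ) = f(xⱼ)`, hence `|xᵢ| = |xⱼ|` on the hyperplane,
which leaves only the bisectors.

For a stationary half-space, stability is the weighted Poincaré inequality
`2 ∫ F ∑ vᵢ² f(xᵢ) φ² ≤ ∫ F |∇φ|²` for mean zero `φ` on the hyperplane.

* Coordinate half-spaces: the left-hand side is `2 f(t) ∫ F φ²`, and the logistic measure, hence
  each of its powers, satisfies the Poincaré inequality with constant `4`, so that `f(t) ≤ 1/8`
  suffices.
* Bisector of the plane: with arc length rescaled, the inequality is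
  `4 ∫ f³ u² ≤ ∫ f² u'²` if `∫ f² u = 0`. Picone's identity with the Jacobi function `s` gives
  `6 ∫ f³ (u - u(0))² ≤ ∫ f² u'²`, and `4 ∫ f³ u² ≤ 6 ∫ f³ (u - u(0))²` by completing the square.
* Bisectors in higher dimension: a function of the form `s + s³` of a third coordinate is odd,
  hence of mean zero, and violates the inequality.
-/

noncomputable section

namespace HalfSpaceStability

open MeasureTheory Filter Topology Set ProbabilityTheory

/-! ### The logistic density on the line -/

/-- The score of the logistic density, that is, minus its logarithmic derivative. It equals
`tanh (x / 2)`. -/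
def score (x : ℝ) : ℝ := 2 * Real.sigmoid x - 1

lemma logisticDensity_eq_sigmoid (x : ℝ) :
    logisticDensity x = Real.sigmoid x * (1 - Real.sigmoid x) := by
  have := Real.exp_pos x
  rw [logisticDensity, Real.sigmoid_def, Real.exp_neg]
  field_simp
  ring

lemma logisticDensity_eq_score (x : ℝ) : logisticDensity x = (1 - score x ^ 2) / 4 := by
  rw [logisticDensity_eq_sigmoid, score]
  ring

lemma logisticDensity_pos (x : ℝ) : 0 < logisticDensity x := by
  unfold logisticDensity
  positivity

lemma logisticDensity_le_one_fourth (x : ℝ) : logisticDensity x ≤ 1 / 4 := by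
  rw [logisticDensity_eq_score]
  linarith [sq_nonneg (score x)]

lemma abs_score_le_one (x : ℝ) : |score x| ≤ 1 := by
  rw [score, abs_le]
  constructor <;> linarith [Real.sigmoid_nonneg x, Real.sigmoid_le_one x]

lemma score_neg (x : ℝ) : score (-x) = -score x := by
  rw [score, score, Real.sigmoid_neg]
  ring

lemma score_zero : score 0 = 0 := by simp [score]

lemma score_strictMono : StrictMono score := fun x y hxy => by
  simp only [score]
  linarith [Real.sigmoid_lt hxy]

lemma logisticDensity_neg (x : ℝ) : logisticDensity (-x) = logisticDensity x := by
  simp only [logisticDensity_eq_score, score_neg, neg_sq]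

lemma logisticDensity_abs (x : ℝ) : logisticDensity |x| = logisticDensity x := by
  rcases abs_choice x with h | h <;> rw [h]
  exact logisticDensity_neg x

lemma hasDerivAt_score (x : ℝ) : HasDerivAt score (2 * logisticDensity x) x := by
  rw [logisticDensity_eq_sigmoid]
  exact ((Real.hasDerivAt_sigmoid x).const_mul 2).sub_const 1

lemma hasDerivAt_logisticDensity (x : ℝ) :
    HasDerivAt logisticDensity (-(score x * logisticDensity x)) x := by
  have h := (((hasDerivAt_score x).fun_pow 2).const_sub 1).div_const 4
  rw [← funext logisticDensity_eq_score] at h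
  exact h.congr_deriv (by push_cast; ring)

lemma hasDerivAt_log_logisticDensity (x : ℝ) :
    HasDerivAt (fun y => Real.log (logisticDensity y)) (-score x) x := by
  have hpos := (logisticDensity_pos x).ne'
  exact ((hasDerivAt_logisticDensity x).log hpos).congr_deriv (by field_simp)

lemma continuous_logisticDensity : Continuous logisticDensity :=
  continuous_iff_continuousAt.2 fun x => (hasDerivAt_logisticDensity x).continuousAt

lemma contDiff_score {n : ℕ∞} : ContDiff ℝ n score :=
  (contDiff_const.mul (contDiff_sigmoid.of_le (by simp))).sub contDiff_const

lemma logisticDensity_le_one_eighth {t : ℝ} (ht : 2 * Real.log (1 + √2) ≤ |t|) :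
    logisticDensity t ≤ 1 / 8 := by
  rw [← logisticDensity_abs, logisticDensity, div_le_div_iff₀ (by positivity) (by norm_num)]
  have hsqrt : √2 ^ 2 = 2 := Real.sq_sqrt (by norm_num)
  have hexp : (1 + √2) ^ 2 ≤ Real.exp |t| := by
    rw [← Real.exp_log (by positivity : 0 < 1 + √2), ← Real.exp_nat_mul]
    exact Real.exp_le_exp.2 (by exact_mod_cast ht)
  nlinarith [Real.sqrt_nonneg 2]

lemma integrable_logisticDensity : Integrable logisticDensity := by
  have h := integrableOn_image_iff_integrableOn_abs_deriv_smul (s := univ) MeasurableSet.univ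
    (fun x _ => (Real.hasDerivAt_sigmoid x).hasDerivWithinAt) Real.sigmoid_injective.injOn
    (fun _ => (1 : ℝ))
  rw [image_univ, Real.range_sigmoid, integrableOn_univ] at h
  refine (h.1 (by simp)).congr (ae_of_all _ fun x => ?_)
  simp only [← logisticDensity_eq_sigmoid, abs_of_pos (logisticDensity_pos x), smul_eq_mul,
    mul_one]

lemma integral_logisticDensity_mul_comp_score (G : ℝ → ℝ) :
    ∫ x, logisticDensity x * G (score x) = (∫ s in (-1 : ℝ)..1, G s) / 2 := by
  have hsubst := integral_image_eq_integral_abs_deriv_smul (s := univ) MeasurableSet.univ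
    (fun x _ => (Real.hasDerivAt_sigmoid x).hasDerivWithinAt) Real.sigmoid_injective.injOn
    fun y => G (2 * y - 1)
  rw [image_univ, Real.range_sigmoid, setIntegral_univ, ← integral_Ioc_eq_integral_Ioo,
    ← intervalIntegral.integral_of_le zero_le_one,
    intervalIntegral.integral_comp_mul_sub G two_ne_zero] at hsubst
  simp only [← logisticDensity_eq_sigmoid, abs_of_pos (logisticDensity_pos _), smul_eq_mul]
    at hsubst
  norm_num at hsubst
  rw [div_eq_inv_mul, ← one_div, hsubst]
  rfl

lemma integral_logisticDensity : ∫ x, logisticDensity x = 1 := by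
  simpa using integral_logisticDensity_mul_comp_score fun _ => 1

open Polynomial in
lemma integral_logisticDensity_mul_eval_derivative_score (P : ℝ[X]) :
    ∫ x, logisticDensity x * P.derivative.eval (score x) = (P.eval 1 - P.eval (-1)) / 2 := by
  rw [integral_logisticDensity_mul_comp_score (P.derivative.eval ·),
    intervalIntegral.integral_eq_sub_of_hasDerivAt (fun s _ => P.hasDerivAt s)
      (P.derivative.continuous.intervalIntegrable _ _)]

open Polynomial in
lemma integral_logisticDensity_sq : ∫ x, logisticDensity x ^ 2 = 1 / 6 := by
  convert integral_logisticDensity_mul_eval_derivative_score (C (1 / 12) * (3 * X - X ^ 3)) using 1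
  · congr 1 with x
    simp only [logisticDensity_eq_score, one_div, derivative_mul, derivative_C, zero_mul,
      derivative_sub, derivative_ofNat, derivative_X, mul_one, zero_add, derivative_X_pow_succ,
      Nat.cast_ofNat, map_add, map_one, eval_mul, eval_C, eval_sub, eval_ofNat, eval_add, eval_one,
      eval_pow, eval_X]
    ring
  · norm_num

open Polynomial in
lemma integral_logisticDensity_cube : ∫ x, logisticDensity x ^ 3 = 1 / 30 := by
  convert integral_logisticDensity_mul_eval_derivative_score
    (C (1 / 240) * (15 * X - 10 * X ^ 3 + 3 * X ^ 5)) using 1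
  · congr 1 with x
    simp only [logisticDensity_eq_score, one_div, derivative_mul, derivative_C, zero_mul,
      derivative_sub, derivative_ofNat, derivative_X, mul_one, zero_add,
      derivative_X_pow_succ, Nat.cast_ofNat, map_add, map_one, eval_mul, eval_C, eval_add, eval_sub,
      eval_ofNat, eval_one, eval_pow, eval_X]
    ring
  · norm_num

lemma integrable_logisticDensity_mul {G : ℝ → ℝ} (hG : Continuous G) {C : ℝ}
    (hC : ∀ x, |G x| ≤ C) : Integrable fun x => logisticDensity x * G x :=
  integrable_logisticDensity.mul_bdd hG.aestronglyMeasurable (ae_of_all _ hC)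

lemma integrable_logisticDensity_pow (n : ℕ) :
    Integrable fun x => logisticDensity x ^ (n + 1) := by
  refine (integrable_logisticDensity_mul (continuous_logisticDensity.pow n) (C := 1)
    fun x => ?_).congr (ae_of_all _ fun x => (pow_succ' _ _).symm)
  have hpos := logisticDensity_pos x
  rw [Pi.pow_apply, abs_of_pos (pow_pos hpos n)]
  exact pow_le_one₀ hpos.le ((logisticDensity_le_one_fourth x).trans (by norm_num))

/-! ### Weighted Hardy inequalities from Jacobi functions -/

/-- `h` is an increasing solution of the Jacobi equation `(p h')' + V h = 0`, the Euler-Lagrange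
equation of the quadratic form `∫ p w'² - V w²`. -/
structure IsIncreasingJacobi (p V h h' : ℝ → ℝ) : Prop where
  continuous_weight : Continuous p
  continuous_potential : Continuous V
  weight_pos : ∀ x, 0 < p x
  deriv_pos : ∀ x, 0 < h' x
  hasDerivAt : ∀ x, HasDerivAt h (h' x) x
  hasDerivAt_flux : ∀ x, HasDerivAt (fun x => p x * h' x) (-(V x * h x)) x

namespace IsIncreasingJacobi

variable {p V h h' w w' : ℝ → ℝ} {a b : ℝ}

lemma strictMono (hJ : IsIncreasingJacobi p V h h') : StrictMono h :=
  strictMono_of_hasDerivAt_pos hJ.hasDerivAt hJ.deriv_pos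

lemma comp_neg (hJ : IsIncreasingJacobi p V h h') :
    IsIncreasingJacobi (fun x => p (-x)) (fun x => V (-x)) (fun x => -h (-x))
      (fun x => h' (-x)) where
  continuous_weight := hJ.continuous_weight.comp continuous_neg
  continuous_potential := hJ.continuous_potential.comp continuous_neg
  weight_pos x := hJ.weight_pos (-x)
  deriv_pos x := hJ.deriv_pos (-x)
  hasDerivAt x := by
    simpa [Function.comp_def] using ((hJ.hasDerivAt (-x)).comp x (hasDerivAt_neg x)).fun_neg
  hasDerivAt_flux x := by
    simpa [Function.comp_def] using (hJ.hasDerivAt_flux (-x)).comp x (hasDerivAt_neg x)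

lemma hasDerivAt_flux_mul_sq_div (hJ : IsIncreasingJacobi p V h h') {x : ℝ} (hx : h x ≠ 0)
    (hw : HasDerivAt w (w' x) x) :
    HasDerivAt (fun x => p x * h' x * (w x ^ 2 / h x))
      (p x * w' x ^ 2 - V x * w x ^ 2 - p x * (w' x - h' x * (w x / h x)) ^ 2) x := by
  refine ((hJ.hasDerivAt_flux x).fun_mul
    ((hw.fun_pow 2).fun_div (hJ.hasDerivAt x) hx)).congr_deriv ?_
  push_cast
  field_simp
  ring

lemma continuousAt_flux_mul_sq_div (hJ : IsIncreasingJacobi p V h h') (ha : h a = 0)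
    (hw : HasDerivAt w (w' a) a) (hwa : w a = 0) :
    ContinuousAt (fun x => p x * h' x * (w x ^ 2 / h x)) a := by
  have hratio : Tendsto (fun x => w x / h x) (𝓝[≠] a) (𝓝 (w' a / h' a)) := by
    refine ((hasDerivAt_iff_tendsto_slope.1 hw).div
      (hasDerivAt_iff_tendsto_slope.1 (hJ.hasDerivAt a)) (hJ.deriv_pos a).ne').congr' ?_
    filter_upwards [self_mem_nhdsWithin] with x hx
    have hxa : x - a ≠ 0 := sub_ne_zero.2 hx
    simp only [Pi.div_apply, slope_def_field, hwa, ha, sub_zero]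
    field_simp
  rw [continuousAt_iff_punctured_nhds]
  refine ((((hJ.hasDerivAt_flux a).continuousAt.fun_mul
    hw.continuousAt).continuousWithinAt.tendsto.mul
    hratio).congr fun x => ?_).trans (by simp [hwa])
  ring

/-- Picone's identity exhibits `p w'² - V w²` as a derivative plus a square. -/
lemma intervalIntegral_mul_sq_le (hJ : IsIncreasingJacobi p V h h') (ha : h a = 0)
    (hw : ∀ x, HasDerivAt w (w' x) x) (hw' : Continuous w') (hwa : w a = 0) (hab : a ≤ b) :
    ∫ x in a..b, V x * w x ^ 2 ≤ ∫ x in a..b, p x * w' x ^ 2 := by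
  have hp := hJ.continuous_weight
  have hV := hJ.continuous_potential
  have hwc : Continuous w := continuous_iff_continuousAt.2 fun x => (hw x).continuousAt
  have hderiv : ∀ x, a < x → HasDerivAt (fun x => p x * h' x * (w x ^ 2 / h x))
      (p x * w' x ^ 2 - V x * w x ^ 2 - p x * (w' x - h' x * (w x / h x)) ^ 2) x := fun x hx =>
    hJ.hasDerivAt_flux_mul_sq_div (ha ▸ hJ.strictMono hx).ne' (hw x)
  have hcont : ContinuousOn (fun x => p x * h' x * (w x ^ 2 / h x)) (Icc a b) := fun x hx => by
    rcases hx.1.eq_or_lt with rfl | hax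
    · exact (hJ.continuousAt_flux_mul_sq_div ha (hw _) hwa).continuousWithinAt
    · exact (hderiv x hax).continuousAt.continuousWithinAt
  have hle := intervalIntegral.sub_le_integral_of_hasDeriv_right_of_le hab hcont
    (fun x hx => (hderiv x hx.1).hasDerivWithinAt) (φ := fun x => p x * w' x ^ 2 - V x * w x ^ 2)
    (by fun_prop : Continuous _).continuousOn.integrableOn_Icc
    (fun x _ => sub_le_self _ (mul_nonneg (hJ.weight_pos x).le (sq_nonneg _)))
  have hend : 0 ≤ p b * h' b * (w b ^ 2 / h b) :=
    mul_nonneg (mul_pos (hJ.weight_pos b) (hJ.deriv_pos b)).le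
      (div_nonneg (sq_nonneg _) (ha ▸ hJ.strictMono.monotone hab))
  rw [intervalIntegral.integral_sub (Continuous.intervalIntegrable (by fun_prop) _ _)
    (Continuous.intervalIntegrable (by fun_prop) _ _)] at hle
  simp only [ha, hwa] at hle
  linarith

lemma integral_mul_sq_le (hJ : IsIncreasingJacobi p V h h') (ha : h a = 0)
    (hw : ∀ x, HasDerivAt w (w' x) x) (hw' : Continuous w') (hwa : w a = 0)
    (hVw : Integrable fun x => V x * w x ^ 2) (hpw : Integrable fun x => p x * w' x ^ 2) :
    ∫ x, V x * w x ^ 2 ≤ ∫ x, p x * w' x ^ 2 := by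
  refine le_of_tendsto_of_tendsto
    (intervalIntegral_tendsto_integral hVw tendsto_neg_atTop_atBot tendsto_id)
    (intervalIntegral_tendsto_integral hpw tendsto_neg_atTop_atBot tendsto_id) ?_
  filter_upwards [eventually_ge_atTop |a|] with b hb
  have hright := hJ.intervalIntegral_mul_sq_le ha hw hw' hwa (le_of_abs_le hb)
  have hleft := hJ.comp_neg.intervalIntegral_mul_sq_le (a := -a) (b := b)
    (w := fun x => w (-x)) (w' := fun x => -w' (-x)) (by simpa using ha)
    (fun x => by simpa [Function.comp_def] using (hw (-x)).comp x (hasDerivAt_neg x))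
    (by fun_prop) (by simpa using hwa) ((neg_le_abs a).trans hb)
  simp only [neg_sq] at hleft
  rw [intervalIntegral.integral_comp_neg (fun x => V x * w x ^ 2),
    intervalIntegral.integral_comp_neg (fun x => p x * w' x ^ 2), neg_neg] at hleft
  rw [id, ← intervalIntegral.integral_add_adjacent_intervals (b := a)
      hVw.intervalIntegrable hVw.intervalIntegrable,
    ← intervalIntegral.integral_add_adjacent_intervals (b := a)
      hpw.intervalIntegrable hpw.intervalIntegrable]
  exact add_le_add hleft hright

end IsIncreasingJacobi

lemma score_mul_cosh_half (x : ℝ) : score x * Real.cosh (x / 2) = Real.sinh (x / 2) := by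
  have hexp : Real.exp (-x) = Real.exp (-(x / 2)) ^ 2 := by
    rw [← Real.exp_nat_mul]
    ring_nf
  have hmul : Real.exp (x / 2) * Real.exp (-(x / 2)) = 1 := by rw [← Real.exp_add]; simp
  rw [score, Real.sigmoid_def, Real.cosh_eq, Real.sinh_eq, hexp]
  field_simp
  linear_combination (-2 * Real.exp (-(x / 2))) * hmul

lemma isIncreasingJacobi_sinh_half :
    IsIncreasingJacobi logisticDensity (fun x => logisticDensity x / 4)
      (fun x => Real.sinh (x / 2)) (fun x => Real.cosh (x / 2) / 2) where
  continuous_weight := continuous_logisticDensity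
  continuous_potential := continuous_logisticDensity.div_const 4
  weight_pos := logisticDensity_pos
  deriv_pos x := half_pos (Real.cosh_pos _)
  hasDerivAt x := ((hasDerivAt_id x).div_const 2).sinh.congr_deriv (by simp [div_eq_mul_inv])
  hasDerivAt_flux x := by
    refine ((hasDerivAt_logisticDensity x).fun_mul
      (((hasDerivAt_id x).div_const 2).cosh.div_const 2)).congr_deriv ?_
    simp only [id, ← score_mul_cosh_half x]
    ring

lemma isIncreasingJacobi_score :
    IsIncreasingJacobi (fun x => logisticDensity x ^ 2) (fun x => 6 * logisticDensity x ^ 3)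
      score (fun x => 2 * logisticDensity x) where
  continuous_weight := continuous_logisticDensity.pow 2
  continuous_potential := (continuous_logisticDensity.pow 3).const_mul 6
  weight_pos x := pow_pos (logisticDensity_pos x) 2
  deriv_pos x := mul_pos two_pos (logisticDensity_pos x)
  hasDerivAt := hasDerivAt_score
  hasDerivAt_flux x :=
    (((hasDerivAt_logisticDensity x).fun_pow 2).fun_mul
      ((hasDerivAt_logisticDensity x).const_mul 2)).congr_deriv (by push_cast; ring)

section OneVariable

variable {u : ℝ → ℝ}

lemma integrable_mul_of_hasCompactSupport {p : ℝ → ℝ} (hp : Continuous p) (hu : Continuous u)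
    (hs : HasCompactSupport u) : Integrable fun x => p x * u x :=
  (hp.mul hu).integrable_of_hasCompactSupport hs.mul_left

lemma integrable_mul_sq_of_hasCompactSupport {p : ℝ → ℝ} (hp : Continuous p) (hu : Continuous u)
    (hs : HasCompactSupport u) : Integrable fun x => p x * u x ^ 2 :=
  integrable_mul_of_hasCompactSupport hp (hu.pow 2) (hs.comp_left (zero_pow two_ne_zero))

lemma integrable_logisticDensity_pow_mul_sub_sq (hu : Continuous u) (hs : HasCompactSupport u)
    (c : ℝ) (n : ℕ) : Integrable fun x => logisticDensity x ^ (n + 1) * (u x - c) ^ 2 := by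
  have hf := continuous_logisticDensity.pow (n + 1)
  refine (((integrable_mul_sq_of_hasCompactSupport hf hu hs).add
    ((integrable_mul_of_hasCompactSupport hf hu hs).const_mul (-2 * c))).add
    ((integrable_logisticDensity_pow n).const_mul (c ^ 2))).congr (ae_of_all _ fun x => ?_)
  simp only [Pi.add_apply, Pi.pow_apply]
  ring

lemma integral_logisticDensity_mul_sub_sq_le (hu : ContDiff ℝ 1 u) (hs : HasCompactSupport u) :
    ∫ x, logisticDensity x * (u x - u 0) ^ 2 ≤ 4 * ∫ x, logisticDensity x * deriv u x ^ 2 := by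
  have hu' := hu.continuous_deriv le_rfl
  have hint := integrable_logisticDensity_pow_mul_sub_sq hu.continuous hs (u 0) 0
  simp only [zero_add, pow_one] at hint
  have hle := isIncreasingJacobi_sinh_half.integral_mul_sq_le (a := 0) (by simp)
    (fun x => ((hu.differentiable one_ne_zero x).hasDerivAt).sub_const (u 0)) hu' (sub_self _)
    ((hint.div_const 4).congr (ae_of_all _ fun x => by ring))
    (integrable_mul_sq_of_hasCompactSupport continuous_logisticDensity hu' hs.deriv)
  simp only [div_mul_eq_mul_div, integral_div] at hle
  linarith

lemma integral_logisticDensity_cube_mul_sub_sq_le (hu : ContDiff ℝ 1 u)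
    (hs : HasCompactSupport u) :
    6 * ∫ x, logisticDensity x ^ 3 * (u x - u 0) ^ 2 ≤
      ∫ x, logisticDensity x ^ 2 * deriv u x ^ 2 := by
  have hu' := hu.continuous_deriv le_rfl
  have hint := integrable_logisticDensity_pow_mul_sub_sq hu.continuous hs (u 0) 2
  have hle := isIncreasingJacobi_score.integral_mul_sq_le score_zero
    (fun x => ((hu.differentiable one_ne_zero x).hasDerivAt).sub_const (u 0)) hu' (sub_self _)
    ((hint.const_mul 6).congr (ae_of_all _ fun x => by ring))
    (integrable_mul_sq_of_hasCompactSupport (continuous_logisticDensity.pow 2) hu' hs.deriv)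
  simpa only [mul_assoc, integral_const_mul] using hle

/-- The difference of the integrands on the two sides, `6 f³ (u - c)² - 4 f³ u²`, is the square
`2 f (f u + c (1 - 6 f) / 2)²` plus a combination of `f`, `f²`, `f³` and `f² u`. -/
lemma four_mul_integral_logisticDensity_cube_mul_sq_le (hu : Continuous u)
    (hs : HasCompactSupport u) (h0 : ∫ x, logisticDensity x ^ 2 * u x = 0) (c : ℝ) :
    4 * ∫ x, logisticDensity x ^ 3 * u x ^ 2 ≤
      6 * ∫ x, logisticDensity x ^ 3 * (u x - c) ^ 2 := by
  have hf := continuous_logisticDensity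
  have hcube := (integrable_logisticDensity_pow 2).const_mul (-12 * c ^ 2)
  have hsq := (integrable_logisticDensity_pow 1).const_mul (6 * c ^ 2)
  have hone := integrable_logisticDensity.const_mul (-c ^ 2 / 2)
  have hlin := (integrable_mul_of_hasCompactSupport (hf.pow 2) hu hs).const_mul (-2 * c)
  have hquad := (integrable_mul_sq_of_hasCompactSupport (hf.pow 3) hu hs).const_mul 4
  have hmono := integral_mono
    ((((hquad.fun_add hsq).fun_add hcube).fun_add hone).fun_add hlin)
    ((integrable_logisticDensity_pow_mul_sub_sq hu hs c 2).const_mul 6) fun x => by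
      have hsquare := mul_nonneg (logisticDensity_pos x).le
        (sq_nonneg (logisticDensity x * u x + c * (1 - 6 * logisticDensity x) / 2))
      simp only [Pi.pow_apply]
      linarith
  rw [integral_add (((hquad.fun_add hsq).fun_add hcube).fun_add hone) hlin,
    integral_add ((hquad.fun_add hsq).fun_add hcube) hone, integral_add (hquad.fun_add hsq) hcube,
    integral_add hquad hsq] at hmono
  simp only [integral_const_mul, Pi.pow_apply, Nat.reduceAdd, h0, integral_logisticDensity,
    integral_logisticDensity_sq, integral_logisticDensity_cube] at hmono
  linarith [sq_nonneg c]

lemma four_mul_integral_logisticDensity_cube_mul_sq_le_deriv (hu : ContDiff ℝ 1 u)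
    (hs : HasCompactSupport u) (h0 : ∫ x, logisticDensity x ^ 2 * u x = 0) :
    4 * ∫ x, logisticDensity x ^ 3 * u x ^ 2 ≤ ∫ x, logisticDensity x ^ 2 * deriv u x ^ 2 :=
  (four_mul_integral_logisticDensity_cube_mul_sq_le hu.continuous hs h0 (u 0)).trans
    (integral_logisticDensity_cube_mul_sub_sq_le hu hs)

end OneVariable

/-! ### Variance of functions of two independent variables -/

section VarianceProd

variable {X Y : Type*} [MeasurableSpace X] [MeasurableSpace Y] {μ : Measure X} {ν : Measure Y}
  [IsProbabilityMeasure μ] [IsProbabilityMeasure ν] {u : X × Y → ℝ}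

lemma sq_integral_le_integral_sq {g : X → ℝ} (hg : MemLp g 2 μ) :
    (∫ x, g x ∂μ) ^ 2 ≤ ∫ x, g x ^ 2 ∂μ := by
  have h := variance_nonneg g μ
  rw [variance_eq_sub hg] at h
  exact sub_nonneg.1 h

lemma ae_memLp_two_prodMk_left (hu : MemLp u 2 (μ.prod ν)) :
    ∀ᵐ x ∂μ, MemLp (fun y => u (x, y)) 2 ν := by
  filter_upwards [hu.integrable_sq.prod_right_ae, hu.1.prodMk_left] with x hsq hmeas
  exact (memLp_two_iff_integrable_sq hmeas).2 hsq

lemma memLp_two_integral_right (hu : MemLp u 2 (μ.prod ν)) :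
    MemLp (fun x => ∫ y, u (x, y) ∂ν) 2 μ := by
  refine (memLp_two_iff_integrable_sq hu.1.integral_prod_right').2
    (hu.integrable_sq.integral_prod_left.mono' (hu.1.integral_prod_right'.pow 2) ?_)
  filter_upwards [ae_memLp_two_prodMk_left hu] with x hx
  rw [Real.norm_of_nonneg (by positivity)]
  exact sq_integral_le_integral_sq hx

lemma integral_variance_eq (hu : MemLp u 2 (μ.prod ν)) :
    ∫ x, Var[fun y => u (x, y); ν] ∂μ =
      ∫ z, u z ^ 2 ∂(μ.prod ν) - ∫ x, (∫ y, u (x, y) ∂ν) ^ 2 ∂μ := by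
  rw [integral_prod _ hu.integrable_sq,
    ← integral_sub hu.integrable_sq.integral_prod_left (memLp_two_integral_right hu).integrable_sq]
  refine integral_congr_ae ?_
  filter_upwards [ae_memLp_two_prodMk_left hu] with x hx
  exact variance_eq_sub hx

lemma variance_prod_eq (hu : MemLp u 2 (μ.prod ν)) :
    Var[u; μ.prod ν] =
      ∫ x, Var[fun y => u (x, y); ν] ∂μ + Var[fun x => ∫ y, u (x, y) ∂ν; μ] := by
  rw [integral_variance_eq hu, variance_eq_sub hu, variance_eq_sub (memLp_two_integral_right hu),
    ← integral_prod _ (hu.integrable one_le_two)]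
  simp only [Pi.pow_apply]
  ring

lemma variance_integral_le (hu : MemLp u 2 (μ.prod ν)) :
    Var[fun x => ∫ y, u (x, y) ∂ν; μ] ≤ ∫ y, Var[fun x => u (x, y); μ] ∂ν := by
  have hswap : MemLp (fun z : Y × X => u (z.2, z.1)) 2 (ν.prod μ) :=
    hu.comp_measurePreserving Measure.measurePreserving_swap
  have hcol : MemLp (fun y => ∫ x, u (x, y) ∂μ) 2 ν := memLp_two_integral_right hswap
  have hcenter : MemLp (fun z => u z - ∫ x, u (x, z.2) ∂μ) 2 (μ.prod ν) :=
    hu.sub (hcol.comp_measurePreserving measurePreserving_snd)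
  calc Var[fun x => ∫ y, u (x, y) ∂ν; μ]
      = ∫ x, (∫ y, (u (x, y) - ∫ x', u (x', y) ∂μ) ∂ν) ^ 2 ∂μ := by
        rw [variance_eq_integral (memLp_two_integral_right hu).1.aemeasurable]
        refine integral_congr_ae ?_
        filter_upwards [(hu.integrable one_le_two).prod_right_ae] with x hx
        rw [integral_sub hx (hcol.integrable one_le_two),
          integral_integral_swap (f := fun x y => u (x, y)) (hu.integrable one_le_two)]
    _ ≤ ∫ x, ∫ y, (u (x, y) - ∫ x', u (x', y) ∂μ) ^ 2 ∂ν ∂μ := by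
        refine integral_mono_ae (memLp_two_integral_right hcenter).integrable_sq
          hcenter.integrable_sq.integral_prod_left ?_
        filter_upwards [ae_memLp_two_prodMk_left hcenter] with x hx
        exact sq_integral_le_integral_sq hx
    _ = ∫ y, Var[fun x => u (x, y); μ] ∂ν := by
        rw [integral_integral_swap (f := fun x y => (u (x, y) - ∫ x', u (x', y) ∂μ) ^ 2)
          hcenter.integrable_sq]
        refine integral_congr_ae ?_
        filter_upwards [hswap.1.prodMk_left] with y hy
        exact (variance_eq_integral hy.aemeasurable).symm

lemma variance_prod_le (hu : MemLp u 2 (μ.prod ν)) :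
    Var[u; μ.prod ν] ≤
      ∫ y, Var[fun x => u (x, y); μ] ∂ν + ∫ x, Var[fun y => u (x, y); ν] ∂μ := by
  rw [variance_prod_eq hu, add_comm]
  gcongr
  exact variance_integral_le hu

end VarianceProd

/-! ### Poincaré inequalities -/

/-- The probability measure `μ` satisfies the Poincaré inequality with constant `C`, tested on
compactly supported `C¹` functions. -/
def SatisfiesPoincare {E : Type*} [NormedAddCommGroup E] [NormedSpace ℝ E] [MeasurableSpace E]
    (μ : Measure E) (C : ℝ) : Prop :=
  ∀ u : E → ℝ, ContDiff ℝ 1 u → HasCompactSupport u →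
    Var[u; μ] ≤ C * ∫ x, ‖fderiv ℝ u x‖ ^ 2 ∂μ

lemma norm_fderiv_comp_linearIsometryEquiv {E F : Type*} [NormedAddCommGroup E]
    [NormedSpace ℝ E] [NormedAddCommGroup F] [NormedSpace ℝ F] (u : F → ℝ) (e : E ≃ₗᵢ[ℝ] F)
    (x : E) : ‖fderiv ℝ (u ∘ e) x‖ = ‖fderiv ℝ u (e x)‖ :=
  (congrArg norm e.toContinuousLinearEquiv.comp_right_fderiv).trans
    (ContinuousLinearMap.opNorm_comp_linearIsometryEquiv _ e)

lemma integrable_norm_sq_fderiv_comp {E G : Type*} [NormedAddCommGroup E] [NormedSpace ℝ E]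
    [MeasurableSpace E] [BorelSpace E] [NormedAddCommGroup G] [NormedSpace ℝ G] {μ : Measure E}
    [IsFiniteMeasureOnCompacts μ] {u : E → ℝ} (hu : ContDiff ℝ 1 u) (hs : HasCompactSupport u)
    (B : G →L[ℝ] E) : Integrable (fun x => ‖fderiv ℝ u x ∘L B‖ ^ 2) μ := by
  have := hu.continuous_fderiv one_ne_zero
  exact (by fun_prop : Continuous _).integrable_of_hasCompactSupport
    ((hs.fderiv ℝ).comp_left (g := fun A => ‖A ∘L B‖ ^ 2) (by simp))

namespace SatisfiesPoincare

lemma of_subsingleton {E : Type*} [NormedAddCommGroup E] [NormedSpace ℝ E] [MeasurableSpace E]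
    [Subsingleton E] (μ : Measure E) [IsProbabilityMeasure μ] (C : ℝ) :
    SatisfiesPoincare μ C := fun u _ _ => by
  have hconst : u = fun _ => u 0 := funext fun x => congrArg u (Subsingleton.elim x 0)
  rw [hconst, variance_eq_integral aemeasurable_const]
  simp

lemma map {E F : Type*} [NormedAddCommGroup E] [NormedSpace ℝ E] [MeasurableSpace E]
    [BorelSpace E] [NormedAddCommGroup F] [NormedSpace ℝ F] [MeasurableSpace F] [BorelSpace F]
    {μ : Measure E} {C : ℝ} (h : SatisfiesPoincare μ C) (e : E ≃ₗᵢ[ℝ] F) :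
    SatisfiesPoincare (μ.map e) C := fun u hu hs => by
  have hle := h (u ∘ e) (hu.comp e.contDiff) (hs.comp_homeomorph e.toHomeomorph)
  simp only [norm_fderiv_comp_linearIsometryEquiv] at hle
  have hmeas : e.toHomeomorph.toMeasurableEquiv = (e : E → F) := rfl
  rw [← hmeas, variance_map_equiv, integral_map_equiv]
  exact hle

section Slices

variable {E F : Type*} [NormedAddCommGroup E] [NormedSpace ℝ E] [MeasurableSpace E] [BorelSpace E]
  [SecondCountableTopology E] [NormedAddCommGroup F] [NormedSpace ℝ F] [MeasurableSpace F]
  [BorelSpace F] [SecondCountableTopology F] {μ : Measure E} {ν : Measure F}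
  [IsProbabilityMeasure μ] [IsProbabilityMeasure ν] {C : ℝ} {u : E × F → ℝ}

lemma integral_variance_left_le (hμ : SatisfiesPoincare μ C) (hu : ContDiff ℝ 1 u)
    (hs : HasCompactSupport u) :
    ∫ y, Var[fun x => u (x, y); μ] ∂ν ≤
      C * ∫ z, ‖fderiv ℝ u z ∘L ContinuousLinearMap.inl ℝ E F‖ ^ 2 ∂(μ.prod ν) := by
  have hint := integrable_norm_sq_fderiv_comp (μ := μ.prod ν) hu hs
    (ContinuousLinearMap.inl ℝ E F)
  rw [integral_prod_symm _ hint, ← integral_const_mul]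
  refine integral_mono_of_nonneg (ae_of_all _ fun y => variance_nonneg _ _)
    (hint.integral_prod_right.const_mul C) (ae_of_all _ fun y => ?_)
  refine (hμ _ (hu.comp (contDiff_prodMk_left y))
    (hs.comp_isClosedEmbedding (Function.LeftInverse.isClosedEmbedding
      (f := Prod.fst) (fun _ => rfl) continuous_fst (by fun_prop)))).trans_eq ?_
  simp only [fun x => ((hu.differentiable one_ne_zero _).hasFDerivAt.comp x
    (hasFDerivAt_prodMk_left x y)).fderiv]

lemma integral_variance_right_le (hν : SatisfiesPoincare ν C) (hu : ContDiff ℝ 1 u)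
    (hs : HasCompactSupport u) :
    ∫ x, Var[fun y => u (x, y); ν] ∂μ ≤
      C * ∫ z, ‖fderiv ℝ u z ∘L ContinuousLinearMap.inr ℝ E F‖ ^ 2 ∂(μ.prod ν) := by
  have hint := integrable_norm_sq_fderiv_comp (μ := μ.prod ν) hu hs
    (ContinuousLinearMap.inr ℝ E F)
  rw [integral_prod _ hint, ← integral_const_mul]
  refine integral_mono_of_nonneg (ae_of_all _ fun x => variance_nonneg _ _)
    (hint.integral_prod_left.const_mul C) (ae_of_all _ fun x => ?_)
  refine (hν _ (hu.comp (contDiff_prodMk_right x))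
    (hs.comp_isClosedEmbedding (Function.LeftInverse.isClosedEmbedding
      (f := Prod.snd) (fun _ => rfl) continuous_snd (by fun_prop)))).trans_eq ?_
  simp only [fun y => ((hu.differentiable one_ne_zero _).hasFDerivAt.comp y
    (hasFDerivAt_prodMk_right x y)).fderiv]

end Slices

section Prod

variable {E F : Type*} [NormedAddCommGroup E] [InnerProductSpace ℝ E] [CompleteSpace E]
  [NormedAddCommGroup F] [InnerProductSpace ℝ F] [CompleteSpace F]

lemma norm_sq_comp_inl_add_norm_sq_comp_inr (A : StrongDual ℝ (E × F)) :
    ‖A ∘L ContinuousLinearMap.inl ℝ E F‖ ^ 2 + ‖A ∘L ContinuousLinearMap.inr ℝ E F‖ ^ 2 =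
      ‖A ∘L (WithLp.prodContinuousLinearEquiv 2 ℝ E F).toContinuousLinearMap‖ ^ 2 := by
  obtain ⟨g, hg⟩ := (InnerProductSpace.toDual ℝ (WithLp 2 (E × F))).surjective
    (A ∘L (WithLp.prodContinuousLinearEquiv 2 ℝ E F).toContinuousLinearMap)
  have hA : ∀ z, A z = ⟪g, WithLp.toLp 2 z⟫_ℝ := fun z =>
    (DFunLike.congr_fun hg (WithLp.toLp 2 z)).symm
  rw [← hg, LinearIsometryEquiv.norm_map, WithLp.prod_norm_sq_eq_of_L2,
    ← LinearIsometryEquiv.norm_map (InnerProductSpace.toDual ℝ E) g.fst,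
    ← LinearIsometryEquiv.norm_map (InnerProductSpace.toDual ℝ F) g.snd]
  congr 4 <;> ext <;> simp [hA, WithLp.prod_inner_apply]

variable [MeasurableSpace E] [BorelSpace E] [SecondCountableTopology E] [MeasurableSpace F]
  [BorelSpace F] [SecondCountableTopology F] {μ : Measure E} {ν : Measure F}
  [IsProbabilityMeasure μ] [IsProbabilityMeasure ν] {C : ℝ}

lemma prod (hμ : SatisfiesPoincare μ C) (hν : SatisfiesPoincare ν C) :
    SatisfiesPoincare ((μ.prod ν).map (WithLp.toLp 2)) C := fun u hu hs => by
  set U : E × F → ℝ := fun z => u (WithLp.toLp 2 z)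
  have hsU : HasCompactSupport U := hs.comp_homeomorph (WithLp.homeomorphProd 2 E F).symm
  have hcU : ContDiff ℝ 1 U :=
    hu.comp (WithLp.prodContinuousLinearEquiv 2 ℝ E F).symm.contDiff
  have hderiv : ∀ z, fderiv ℝ u (WithLp.toLp 2 z) =
      fderiv ℝ U z ∘L (WithLp.prodContinuousLinearEquiv 2 ℝ E F).toContinuousLinearMap :=
    fun z => (WithLp.prodContinuousLinearEquiv 2 ℝ E F).comp_right_fderiv (f := U)
  rw [← MeasurableEquiv.coe_toLp, variance_map_equiv, integral_map_equiv]
  simp only [MeasurableEquiv.coe_toLp, hderiv, ← norm_sq_comp_inl_add_norm_sq_comp_inr]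
  rw [integral_add (integrable_norm_sq_fderiv_comp hcU hsU _)
    (integrable_norm_sq_fderiv_comp hcU hsU _), mul_add]
  exact (variance_prod_le (hcU.continuous.memLp_of_hasCompactSupport hsU)).trans
    (add_le_add (integral_variance_left_le hμ hcU hsU) (integral_variance_right_le hν hcU hsU))

end Prod
end SatisfiesPoincare

/-! ### The product measure -/

/-- The logistic probability measure on the line. -/
def logisticMeasure : Measure ℝ := volume.withDensity fun x => .ofReal (logisticDensity x)

instance : IsProbabilityMeasure logisticMeasure := ⟨by
  rw [logisticMeasure, withDensity_apply _ MeasurableSet.univ, setLIntegral_univ,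
    ← ofReal_integral_eq_lintegral_ofReal integrable_logisticDensity
      (ae_of_all _ fun x => (logisticDensity_pos x).le),
    integral_logisticDensity, ENNReal.ofReal_one]⟩

lemma integral_withDensity_ofReal {X : Type*} [MeasurableSpace X] {μ : Measure X} {f : X → ℝ}
    (hf : Measurable f) (hpos : ∀ x, 0 ≤ f x) (g : X → ℝ) :
    ∫ x, g x ∂μ.withDensity (fun x => .ofReal (f x)) = ∫ x, f x * g x ∂μ := by
  rw [integral_withDensity_eq_integral_toReal_smul hf.ennreal_ofReal
    (ae_of_all _ fun x => ENNReal.ofReal_lt_top)]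
  simp only [ENNReal.toReal_ofReal (hpos _), smul_eq_mul]

lemma satisfiesPoincare_logisticMeasure : SatisfiesPoincare logisticMeasure 4 := fun u hu hs => by
  have hmeas : AEStronglyMeasurable u logisticMeasure := hu.continuous.aestronglyMeasurable
  have hintegral := integral_withDensity_ofReal (μ := volume)
    continuous_logisticDensity.measurable fun x => (logisticDensity_pos x).le
  calc Var[u; logisticMeasure]
      = Var[fun x => u x - u 0; logisticMeasure] := (variance_sub_const hmeas (u 0)).symm
    _ ≤ ∫ x, (u x - u 0) ^ 2 ∂logisticMeasure :=
        variance_le_expectation_sq (hmeas.sub aestronglyMeasurable_const)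
    _ = ∫ x, logisticDensity x * (u x - u 0) ^ 2 := hintegral _
    _ ≤ 4 * ∫ x, logisticDensity x * deriv u x ^ 2 := integral_logisticDensity_mul_sub_sq_le hu hs
    _ = 4 * ∫ x, ‖fderiv ℝ u x‖ ^ 2 ∂logisticMeasure := by
        rw [logisticMeasure, hintegral]
        simp only [← norm_deriv_eq_norm_fderiv, Real.norm_eq_abs, sq_abs]

/-- The isometry inserting a real number as the `i`-th coordinate. -/
def insertNthIsometry {n : ℕ} (i : Fin (n + 1)) : WithLp 2 (ℝ × Euc n) ≃ₗᵢ[ℝ] Euc (n + 1) where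
  toFun z := WithLp.toLp 2 (i.insertNth z.fst z.snd)
  invFun x := WithLp.toLp 2 (x i, WithLp.toLp 2 fun k => x (i.succAbove k))
  map_add' z w := by ext k; cases k using i.succAboveCases <;> simp
  map_smul' c z := by ext k; cases k using i.succAboveCases <;> simp
  left_inv z := WithLp.ofLp_injective 2 (by ext <;> simp)
  right_inv x := by ext k; cases k using i.succAboveCases <;> simp
  norm_map' z := by
    rw [← sq_eq_sq₀ (norm_nonneg _) (norm_nonneg _), WithLp.prod_norm_sq_eq_of_L2,
      EuclideanSpace.norm_sq_eq, EuclideanSpace.norm_sq_eq, Fin.sum_univ_succAbove _ i]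
    simp

lemma insertNthIsometry_apply_same {n : ℕ} (i : Fin (n + 1)) (z : WithLp 2 (ℝ × Euc n)) :
    insertNthIsometry i z i = z.fst := by
  simp [insertNthIsometry]

lemma logisticProdDensity_insertNthIsometry {n : ℕ} (i : Fin (n + 1))
    (z : WithLp 2 (ℝ × Euc n)) :
    logisticProdDensity (n + 1) (insertNthIsometry i z) =
      logisticDensity z.fst * logisticProdDensity n z.snd := by
  simp [logisticProdDensity, Fin.prod_univ_succAbove _ i, insertNthIsometry]

lemma logisticProdDensity_pos {d : ℕ} (x : Euc d) : 0 < logisticProdDensity d x :=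
  Finset.prod_pos fun _ _ => logisticDensity_pos _

lemma continuous_logisticProdDensity (d : ℕ) : Continuous (logisticProdDensity d) :=
  continuous_finsetProd _ fun i _ => continuous_logisticDensity.comp (by fun_prop)

lemma measurePreserving_withDensity_comp {X Y : Type*} [MeasurableSpace X] [MeasurableSpace Y]
    {μ : Measure X} {ν : Measure Y} {g : X → Y} (hg : MeasurePreserving g μ ν)
    {f : Y → ENNReal} (hf : Measurable f) :
    MeasurePreserving g (μ.withDensity (f ∘ g)) (ν.withDensity f) := by
  refine ⟨hg.measurable, Measure.ext fun s hs => ?_⟩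
  rw [Measure.map_apply hg.measurable hs, withDensity_apply _ (hg.measurable hs),
    withDensity_apply _ hs, ← hg.setLIntegral_comp_preimage hs hf]
  rfl

/-- The product of `d` copies of the logistic measure. -/
def logisticProdMeasure (d : ℕ) : Measure (Euc d) :=
  volume.withDensity fun x => .ofReal (logisticProdDensity d x)

lemma integral_logisticProdMeasure {d : ℕ} (g : Euc d → ℝ) :
    ∫ x, g x ∂logisticProdMeasure d = ∫ x, logisticProdDensity d x * g x :=
  integral_withDensity_ofReal (continuous_logisticProdDensity d).measurable
    (fun x => (logisticProdDensity_pos x).le) g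

lemma logisticProdMeasure_zero : logisticProdMeasure 0 = Measure.dirac 0 := by
  simp [logisticProdMeasure, logisticProdDensity, volume_euclideanSpace_eq_dirac]

lemma logisticProdMeasure_succ (n : ℕ) (i : Fin (n + 1)) :
    logisticProdMeasure (n + 1) =
      ((logisticMeasure.prod (logisticProdMeasure n)).map (WithLp.toLp 2)).map
        (insertNthIsometry i) := by
  have hpres := (insertNthIsometry i).measurePreserving.comp
    (WithLp.volume_preserving_toLp ℝ (Euc n))
  have hdens := (measurePreserving_withDensity_comp hpres
    (continuous_logisticProdDensity (n + 1)).measurable.ennreal_ofReal).map_eq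
  rw [Measure.map_map (insertNthIsometry i).continuous.measurable
    (WithLp.measurable_toLp 2 _), logisticProdMeasure, ← hdens, logisticMeasure,
    logisticProdMeasure, prod_withDensity continuous_logisticDensity.measurable.ennreal_ofReal
      (continuous_logisticProdDensity n).measurable.ennreal_ofReal]
  congr 2 with z
  simp [logisticProdDensity_insertNthIsometry, ENNReal.ofReal_mul (logisticDensity_pos _).le]

instance isProbabilityMeasure_logisticProdMeasure :
    ∀ d, IsProbabilityMeasure (logisticProdMeasure d)
  | 0 => by rw [logisticProdMeasure_zero]; infer_instance
  | n + 1 => by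
    have := isProbabilityMeasure_logisticProdMeasure n
    rw [logisticProdMeasure_succ n 0, Measure.map_map (insertNthIsometry 0).continuous.measurable
      (WithLp.measurable_toLp 2 _)]
    exact Measure.isProbabilityMeasure_map (by fun_prop)

theorem satisfiesPoincare_logisticProdMeasure (d : ℕ) :
    SatisfiesPoincare (logisticProdMeasure d) 4 := by
  induction d with
  | zero => exact .of_subsingleton _ _
  | succ n ih =>
    rw [logisticProdMeasure_succ n 0]
    exact (satisfiesPoincare_logisticMeasure.prod ih).map (insertNthIsometry 0)

/-! ### Half-spaces -/

section Geometry

variable {d : ℕ} {v : Euc d} (t : ℝ)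

lemma preimage_toDual_Iio (v : Euc d) :
    InnerProductSpace.toDual ℝ (Euc d) v ⁻¹' Iio t = halfSpace v t := by
  ext x; simp [halfSpace, real_inner_comm]

lemma toDual_surjective (hv : ‖v‖ = 1) :
    Function.Surjective (InnerProductSpace.toDual ℝ (Euc d) v) := fun r =>
  ⟨r • v, by simp [hv]⟩

lemma closure_halfSpace (hv : ‖v‖ = 1) : closure (halfSpace v t) = {x | ⟪x, v⟫_ℝ ≤ t} := by
  set ξ := InnerProductSpace.toDual ℝ (Euc d) v
  have hopen : IsOpenMap ξ := ξ.isOpenMap (toDual_surjective hv)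
  rw [← preimage_toDual_Iio, ← hopen.preimage_closure_eq_closure_preimage ξ.continuous,
    closure_Iio]
  ext x; simp [ξ, real_inner_comm]

lemma frontier_halfSpace (hv : ‖v‖ = 1) : frontier (halfSpace v t) = {x | ⟪x, v⟫_ℝ = t} := by
  set ξ := InnerProductSpace.toDual ℝ (Euc d) v
  have hopen : IsOpenMap ξ := ξ.isOpenMap (toDual_surjective hv)
  rw [← preimage_toDual_Iio, ← hopen.preimage_frontier_eq_frontier_preimage ξ.continuous,
    frontier_Iio]
  ext x; simp [ξ, real_inner_comm]

lemma infDist_halfSpace (hv : ‖v‖ = 1) (x : Euc d) :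
    Metric.infDist x (halfSpace v t) = max (⟪x, v⟫_ℝ - t) 0 := by
  have hmove (s : ℝ) : ⟪x - s • v, v⟫_ℝ = ⟪x, v⟫_ℝ - s := by
    rw [inner_sub_left, real_inner_smul_left, real_inner_self_eq_norm_sq, hv]; ring
  rw [← Metric.infDist_closure, closure_halfSpace t hv]
  have hfoot : x - max (⟪x, v⟫_ℝ - t) 0 • v ∈ {y : Euc d | ⟪y, v⟫_ℝ ≤ t} := by
    rw [mem_ofPred_eq, hmove]
    linarith [le_max_left (⟪x, v⟫_ℝ - t) 0]
  apply le_antisymm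
  · refine (Metric.infDist_le_dist_of_mem hfoot).trans_eq ?_
    rw [dist_eq_norm, sub_sub_cancel, norm_smul, hv, mul_one, Real.norm_eq_abs,
      abs_of_nonneg (le_max_right _ _)]
  · refine (Metric.le_infDist ⟨_, hfoot⟩).2 fun y hy => max_le ?_ dist_nonneg
    calc ⟪x, v⟫_ℝ - t ≤ ⟪x, v⟫_ℝ - ⟪y, v⟫_ℝ := sub_le_sub_left hy _
      _ = ⟪x - y, v⟫_ℝ := (inner_sub_left _ _ _).symm
      _ ≤ ‖x - y‖ * ‖v‖ := real_inner_le_norm _ _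
      _ = dist x y := by rw [hv, mul_one, dist_eq_norm]

lemma sdist_halfSpace (hv : ‖v‖ = 1) : sdist (halfSpace v t) = fun x => ⟪x, v⟫_ℝ - t := by
  ext x
  have hcompl : (halfSpace v t)ᶜ = closure (halfSpace (-v) (-t)) := by
    rw [closure_halfSpace _ (by rwa [norm_neg])]
    ext y; simp [halfSpace]
  rw [sdist, hcompl, Metric.infDist_closure, infDist_halfSpace t hv,
    infDist_halfSpace (-t) (by rwa [norm_neg]), inner_neg_right, ← neg_sub',
    max_zero_sub_max_neg_zero_eq_self]

lemma normal_halfSpace (hv : ‖v‖ = 1) : normal (halfSpace v t) = fun _ => v := by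
  ext1 x
  rw [normal, sdist_halfSpace t hv]
  refine HasGradientAt.gradient (hasGradientAt_iff_hasFDerivAt.2 (HasFDerivAt.sub_const t ?_))
  exact (InnerProductSpace.toDual ℝ (Euc d) v).hasFDerivAt.congr_of_eventuallyEq
    (.of_forall fun y => by simp [real_inner_comm])

lemma shape_halfSpace (hv : ‖v‖ = 1) (x : Euc d) : shape (halfSpace v t) x = 0 := by
  rw [shape, normal_halfSpace t hv, fderiv_fun_const, Pi.zero_apply]

lemma isOpenC2_halfSpace (hv : ‖v‖ = 1) : IsOpenC2 (halfSpace v t) := by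
  refine ⟨isOpen_lt (by fun_prop) continuous_const, fun p _ => ?_⟩
  rw [sdist_halfSpace t hv]
  exact ((contDiff_id.inner ℝ contDiff_const).sub contDiff_const).contDiffAt

lemma isStationary_halfSpace_iff {N : ℕ} {v : Euc (N + 1)} (hv : ‖v‖ = 1) (t : ℝ)
    (f : Euc (N + 1) → ℝ) :
    IsStationary f (halfSpace v t) ↔
      ∃ c : ℝ, ∀ x, ⟪x, v⟫_ℝ = t → ⟪gradient (fun y => Real.log (f y)) x, v⟫_ℝ = c := by
  simp only [IsStationary, isOpenC2_halfSpace t hv, true_and, frontier_halfSpace t hv,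
    mem_ofPred_eq, genMeanCurv, sumCurv, shape_halfSpace t hv, normal_halfSpace t hv,
    ContinuousLinearMap.toLinearMap_zero, map_zero, neg_zero, zero_sub]
  exact ⟨fun ⟨c, hc⟩ => ⟨-c, fun x hx => neg_eq_iff_eq_neg.1 (hc x hx)⟩,
    fun ⟨c, hc⟩ => ⟨-c, fun x hx => congrArg Neg.neg (hc x hx)⟩⟩

end Geometry

section Chart

variable {N : ℕ} {V : Type*} [NormedAddCommGroup V] [InnerProductSpace ℝ V]

/-- `L` is an isometric parametrization of the hyperplane orthogonal to the unit vector `v`. The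
boundary of `halfSpace v t` is then parametrized by `y ↦ t • v + L y`. -/
structure IsHyperplaneChart (v : Euc (N + 1)) (L : V →ₗᵢ[ℝ] Euc (N + 1)) : Prop where
  norm_eq_one : ‖v‖ = 1
  inner_eq_zero : ∀ y, ⟪L y, v⟫_ℝ = 0
  finrank_eq : Module.finrank ℝ V = N

namespace IsHyperplaneChart

variable {v : Euc (N + 1)} {L : V →ₗᵢ[ℝ] Euc (N + 1)} (h : IsHyperplaneChart v L)

include h

lemma inner_self : ⟪v, v⟫_ℝ = 1 := by
  rw [real_inner_self_eq_norm_sq, h.norm_eq_one, one_pow]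

lemma inner_smul_add (t : ℝ) (y : V) : ⟪t • v + L y, v⟫_ℝ = t := by
  rw [inner_add_left, real_inner_smul_left, h.inner_self, h.inner_eq_zero, mul_one, add_zero]

lemma range_eq_orthogonal : L.range = (ℝ ∙ v)ᗮ := by
  have : Fact (Module.finrank ℝ (Euc (N + 1)) = N + 1) := ⟨finrank_euclideanSpace_fin⟩
  refine Submodule.eq_of_le_of_finrank_eq ?_ ?_
  · rintro _ ⟨y, rfl⟩
    exact Submodule.mem_orthogonal_singleton_iff_inner_left.2 (h.inner_eq_zero y)
  · have hv : v ≠ 0 := norm_ne_zero_iff.1 (h.norm_eq_one ▸ one_ne_zero)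
    rw [Submodule.finrank_orthogonal_span_singleton (n := N) hv]
    exact (LinearMap.finrank_range_of_inj L.injective).trans h.finrank_eq

lemma exists_eq_smul_add (x : Euc (N + 1)) : ∃ y, x = ⟪x, v⟫_ℝ • v + L y := by
  have hx : x - ⟪x, v⟫_ℝ • v ∈ (ℝ ∙ v)ᗮ := by
    rw [Submodule.mem_orthogonal_singleton_iff_inner_left, inner_sub_left, real_inner_smul_left,
      h.inner_self, mul_one, sub_self]
  obtain ⟨y, hy⟩ := h.range_eq_orthogonal ▸ hx
  exact ⟨y, by rw [show L y = _ from hy, add_sub_cancel]⟩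

lemma range_smul_add (t : ℝ) : range (fun y => t • v + L y) = frontier (halfSpace v t) := by
  rw [frontier_halfSpace t h.norm_eq_one]
  ext x
  refine ⟨?_, fun hx => ?_⟩
  · rintro ⟨y, rfl⟩
    exact h.inner_smul_add t y
  · obtain ⟨y, hy⟩ := h.exists_eq_smul_add x
    exact ⟨y, by rw [mem_ofPred_eq] at hx; rw [hx] at hy; exact hy.symm⟩

omit h in
lemma isometry_smul_add (v : Euc (N + 1)) (L : V →ₗᵢ[ℝ] Euc (N + 1)) (t : ℝ) :
    Isometry fun y => t • v + L y :=
  Isometry.of_dist_eq fun x y => by simp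

lemma norm_tanGradient [CompleteSpace V] (t : ℝ) {u : Euc (N + 1) → ℝ}
    (hu : Differentiable ℝ u) (y : V) :
    ‖tanGradient (halfSpace v t) u (t • v + L y)‖ =
      ‖fderiv ℝ (fun z => u (t • v + L z)) y‖ := by
  set g := gradient u (t • v + L y) with hg
  obtain ⟨k, hk⟩ := h.exists_eq_smul_add g
  have htan : tanGradient (halfSpace v t) u (t • v + L y) = L k := by
    rw [tanGradient, normal_halfSpace t h.norm_eq_one, ← hg, sub_eq_iff_eq_add', ← hk]
  have hderiv : fderiv ℝ (fun z => u (t • v + L z)) y = InnerProductSpace.toDual ℝ V k := by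
    ext z
    have hchain := (hu (t • v + L y)).hasFDerivAt.comp y
      (L.toContinuousLinearMap.hasFDerivAt.const_add (t • v))
    calc fderiv ℝ (fun z => u (t • v + L z)) y z = fderiv ℝ u (t • v + L y) (L z) :=
          congrArg (· z) hchain.fderiv
      _ = ⟪g, L z⟫_ℝ := by rw [hg, gradient, InnerProductSpace.toDual_symm_apply]
      _ = ⟪L k, L z⟫_ℝ := by
          rw [hk, inner_add_left, real_inner_smul_left, real_inner_comm (L z) v, h.inner_eq_zero,
            mul_zero, zero_add]
      _ = ⟪k, z⟫_ℝ := L.inner_map_map k z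
  rw [htan, hderiv, L.norm_map, LinearIsometryEquiv.norm_map]

variable [FiniteDimensional ℝ V] [MeasurableSpace V] [BorelSpace V]

lemma integral_area (t : ℝ) (G : Euc (N + 1) → ℝ) :
    ∫ x, G x ∂area (halfSpace v t) = ∫ y, G (t • v + L y) := by
  have hiso := isometry_smul_add v L t
  have hmap := hiso.map_euclideanHausdorffMeasure (d := Module.finrank ℝ V)
  rw [InnerProductSpace.euclideanHausdorffMeasure_eq_volume, h.finrank_eq,
    h.range_smul_add] at hmap
  rw [area, ← hmap, hiso.isClosedEmbedding.measurableEmbedding.integral_map]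

lemma secondVariation_eq (t : ℝ) (f : Euc (N + 1) → ℝ) {u : Euc (N + 1) → ℝ}
    (hu : Differentiable ℝ u) :
    secondVariation f (halfSpace v t) u =
      (∫ y, f (t • v + L y) * ‖fderiv ℝ (fun z => u (t • v + L z)) y‖ ^ 2) +
        ∫ y, f (t • v + L y) * u (t • v + L y) ^ 2 *
          ⟪fderiv ℝ (gradient fun y => Real.log (f y)) (t • v + L y) v, v⟫_ℝ := by
  simp only [secondVariation, h.integral_area, normal_halfSpace t h.norm_eq_one, sumSqCurv,
    shape_halfSpace t h.norm_eq_one, h.norm_tanGradient t hu, ContinuousLinearMap.comp_zero,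
    ContinuousLinearMap.toLinearMap_zero, map_zero, zero_mul, sub_zero]

omit [MeasurableSpace V] [BorelSpace V] in
/-- The extension is `φ ∘ L†` times a cutoff in the normal direction. -/
lemma exists_contDiff_extension (t : ℝ) {φ : V → ℝ} (hφ : ContDiff ℝ ∞ φ)
    (hs : HasCompactSupport φ) :
    ∃ u : Euc (N + 1) → ℝ, ContDiff ℝ ∞ u ∧ HasCompactSupport u ∧
      ∀ y, u (t • v + L y) = φ y := by
  set cutoff : ContDiffBump (0 : ℝ) := default
  set R := L.toContinuousLinearMap.adjoint
  have hRL (y : V) : R (L y) = y := congrArg (· y)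
    ((ContinuousLinearMap.norm_map_iff_adjoint_comp_self L.toContinuousLinearMap).1 L.norm_map)
  have hRv : R v = 0 := ext_inner_right ℝ fun z => by
    rw [ContinuousLinearMap.adjoint_inner_left, inner_zero_left, real_inner_comm]
    exact h.inner_eq_zero z
  have hR (s : ℝ) (y : V) : R (s • v + L y) = y := by
    rw [map_add, map_smul, hRv, smul_zero, zero_add, hRL]
  refine ⟨fun x => φ (R x) * cutoff (⟪x, v⟫_ℝ - t), ?_, ?_, fun y => ?_⟩
  · exact (hφ.comp R.contDiff).mul (cutoff.contDiff.comp
      ((contDiff_id.inner ℝ contDiff_const).sub contDiff_const))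
  · refine HasCompactSupport.intro ((hs.prod cutoff.hasCompactSupport).image
      (f := fun p : V × ℝ => (p.2 + t) • v + L p.1) (by fun_prop)) fun x hx => ?_
    contrapose! hx
    obtain ⟨y, hy⟩ := h.exists_eq_smul_add x
    have hRx : R x = y := by rw [hy, hR]
    refine ⟨(y, ⟪x, v⟫_ℝ - t), ⟨subset_tsupport _ ?_, subset_tsupport _ ?_⟩, ?_⟩
    · exact hRx ▸ left_ne_zero_of_mul hx
    · exact right_ne_zero_of_mul hx
    · simpa using hy.symm
  · simp [hR, h.inner_smul_add, cutoff.one_of_mem_closedBall, cutoff.rIn_pos.le]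

theorem isStable_halfSpace_iff (t : ℝ) (f : Euc (N + 1) → ℝ) :
    IsStable f (halfSpace v t) ↔ IsStationary f (halfSpace v t) ∧
      ∀ φ : V → ℝ, ContDiff ℝ ∞ φ → HasCompactSupport φ →
        ∫ y, f (t • v + L y) * φ y = 0 →
        0 ≤ (∫ y, f (t • v + L y) * ‖fderiv ℝ φ y‖ ^ 2) +
          ∫ y, f (t • v + L y) * φ y ^ 2 *
            ⟪fderiv ℝ (gradient fun y => Real.log (f y)) (t • v + L y) v, v⟫_ℝ := by
  refine and_congr_right fun _ => ⟨fun hstable φ hφ hs hmean => ?_, fun hnonneg u hu hs hmean => ?_⟩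
  · obtain ⟨u, hu, hus, huφ⟩ := h.exists_contDiff_extension t hφ hs
    simpa only [h.secondVariation_eq t f (hu.differentiable (by simp)), huφ] using
      hstable u hu hus (by simpa only [h.integral_area, huφ, mul_comm (φ _)])
  · rw [h.secondVariation_eq t f (hu.differentiable (by simp))]
    simp only [h.integral_area, mul_comm _ (f _)] at hmean
    exact hnonneg (fun y => u (t • v + L y))
      (hu.comp (contDiff_const.add L.contDiff))
      (hs.comp_isClosedEmbedding (isometry_smul_add v L t).isClosedEmbedding) hmean

end IsHyperplaneChart

end Chart

section Hessian

variable {d : ℕ}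

lemma gradient_log_logisticProdDensity :
    gradient (fun y => Real.log (logisticProdDensity d y)) =
      fun x => WithLp.toLp 2 fun i => -score (x i) := by
  ext1 x
  have hlog : (fun y => Real.log (logisticProdDensity d y)) =
      fun y : Euc d => ∑ i, Real.log (logisticDensity (y i)) :=
    funext fun y => Real.log_prod fun i _ => (logisticDensity_pos _).ne'
  refine HasGradientAt.gradient (hasGradientAt_iff_hasFDerivAt.2 ?_)
  rw [hlog]
  have hcoord (i : Fin d) := HasDerivAt.comp_hasFDerivAt (f := fun y : Euc d => y i) x
    (hasDerivAt_log_logisticDensity (x i)) (EuclideanSpace.proj i : Euc d →L[ℝ] ℝ).hasFDerivAt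
  refine (HasFDerivAt.fun_sum fun i _ => hcoord i).congr_fderiv
    (ContinuousLinearMap.ext fun z => ?_)
  simp [PiLp.inner_apply, mul_comm]

lemma inner_hessian_log_logisticProdDensity (x v : Euc d) :
    ⟪fderiv ℝ (gradient fun y => Real.log (logisticProdDensity d y)) x v, v⟫_ℝ =
      -2 * ∑ i, v i ^ 2 * logisticDensity (x i) := by
  rw [gradient_log_logisticProdDensity]
  have hcoord (i : Fin d) := HasDerivAt.comp_hasFDerivAt (f := fun y : Euc d => y i) x
    (hasDerivAt_score (x i)).fun_neg (EuclideanSpace.proj i : Euc d →L[ℝ] ℝ).hasFDerivAt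
  have hderiv := (PiLp.continuousLinearEquiv 2 ℝ
    (fun _ : Fin d => ℝ)).symm.hasFDerivAt.comp x (hasFDerivAt_pi.2 hcoord)
  have hfderiv := congrArg (· v) hderiv.fderiv
  simp only [Function.comp_def, PiLp.continuousLinearEquiv_symm_apply] at hfderiv
  rw [hfderiv, PiLp.inner_apply, Finset.mul_sum]
  refine Finset.sum_congr rfl fun i _ => ?_
  simp only [neg_smul, ContinuousLinearMap.comp_apply, ContinuousLinearMap.coe_pi', neg_apply,
    smul_apply, PiLp.proj_apply, smul_eq_mul, ContinuousLinearEquiv.coe_coe,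
    PiLp.continuousLinearEquiv_symm_apply, RCLike.inner_apply, Real.ringHom_apply, mul_neg, neg_mul,
    neg_inj]
  ring

lemma isStationary_logistic_halfSpace_iff {N : ℕ} {v : Euc (N + 1)} (hv : ‖v‖ = 1) (t : ℝ) :
    IsStationary (logisticProdDensity (N + 1)) (halfSpace v t) ↔
      ∃ c : ℝ, ∀ x : Euc (N + 1), ⟪x, v⟫_ℝ = t → ∑ i, v i * score (x i) = c := by
  have hinner (x : Euc (N + 1)) :
      ⟪gradient (fun y => Real.log (logisticProdDensity (N + 1) y)) x, v⟫_ℝ =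
        -∑ i, v i * score (x i) := by
    simp [gradient_log_logisticProdDensity, PiLp.inner_apply]
  simp only [isStationary_halfSpace_iff hv, hinner]
  exact ⟨fun ⟨c, hc⟩ => ⟨-c, fun x hx => neg_eq_iff_eq_neg.1 (hc x hx)⟩,
    fun ⟨c, hc⟩ => ⟨-c, fun x hx => congrArg Neg.neg (hc x hx)⟩⟩

lemma IsHyperplaneChart.isStable_logistic_halfSpace_iff {N : ℕ} {V : Type*}
    [NormedAddCommGroup V] [InnerProductSpace ℝ V] [FiniteDimensional ℝ V] [MeasurableSpace V]
    [BorelSpace V] {v : Euc (N + 1)} {L : V →ₗᵢ[ℝ] Euc (N + 1)} (h : IsHyperplaneChart v L)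
    (t : ℝ) :
    IsStable (logisticProdDensity (N + 1)) (halfSpace v t) ↔
      IsStationary (logisticProdDensity (N + 1)) (halfSpace v t) ∧
      ∀ φ : V → ℝ, ContDiff ℝ ∞ φ → HasCompactSupport φ →
        ∫ y, logisticProdDensity (N + 1) (t • v + L y) * φ y = 0 →
        2 * ∫ y, logisticProdDensity (N + 1) (t • v + L y) *
            ((∑ i, v i ^ 2 * logisticDensity ((t • v + L y) i)) * φ y ^ 2) ≤
          ∫ y, logisticProdDensity (N + 1) (t • v + L y) * ‖fderiv ℝ φ y‖ ^ 2 := by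
  have hpotential (φ : V → ℝ) (y : V) :
      logisticProdDensity (N + 1) (t • v + L y) * φ y ^ 2 *
          (-2 * ∑ i, v i ^ 2 * logisticDensity ((t • v + L y) i)) =
        -(2 * (logisticProdDensity (N + 1) (t • v + L y) *
          ((∑ i, v i ^ 2 * logisticDensity ((t • v + L y) i)) * φ y ^ 2))) := by ring
  simp only [h.isStable_halfSpace_iff, inner_hessian_log_logisticProdDensity, hpotential,
    integral_neg, integral_const_mul, ← sub_eq_add_neg, sub_nonneg]

end Hessian

/-! ### Coordinate half-spaces -/

section Coordinate

variable {N : ℕ}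

/-- The embedding of `ℝᴺ` in `ℝᴺ⁺¹` as the hyperplane on which the `i`-th coordinate vanishes. -/
def coordinateChart (i : Fin (N + 1)) : Euc N →ₗᵢ[ℝ] Euc (N + 1) where
  toFun y := insertNthIsometry i (WithLp.toLp 2 (0, y))
  map_add' y z := by ext k; cases k using i.succAboveCases <;> simp [insertNthIsometry]
  map_smul' c y := by ext k; cases k using i.succAboveCases <;> simp [insertNthIsometry]
  norm_map' y := by simp

lemma smul_single_add_coordinateChart (i : Fin (N + 1)) (s ε : ℝ) (y : Euc N) :
    s • EuclideanSpace.single i ε + coordinateChart i y =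
      insertNthIsometry i (WithLp.toLp 2 (s * ε, y)) := by
  ext k
  cases k using i.succAboveCases <;> simp [coordinateChart, insertNthIsometry]

lemma isHyperplaneChart_coordinateChart (i : Fin (N + 1)) {ε : ℝ} (hε : |ε| = 1) :
    IsHyperplaneChart (EuclideanSpace.single i ε) (coordinateChart i) where
  norm_eq_one := by simpa
  inner_eq_zero y := by
    simp [coordinateChart, EuclideanSpace.inner_single_right, insertNthIsometry_apply_same]
  finrank_eq := finrank_euclideanSpace_fin

lemma exists_eq_single_of_isCoordinate {v : Euc (N + 1)} (hv : ‖v‖ = 1) (hc : IsCoordinate v) :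
    ∃ i ε, |ε| = 1 ∧ v = EuclideanSpace.single i ε := by
  obtain ⟨i, hi⟩ := hc
  have hsingle : v = EuclideanSpace.single i (v i) := by
    ext k
    by_cases hk : k = i
    · simp [hk]
    · simp [hk, hi k hk]
  refine ⟨i, v i, ?_, hsingle⟩
  rwa [hsingle, PiLp.norm_single] at hv

lemma logisticDensity_mul_of_abs_eq_one (s : ℝ) {ε : ℝ} (hε : |ε| = 1) :
    logisticDensity (s * ε) = logisticDensity s := by
  rw [← logisticDensity_abs, abs_mul, hε, mul_one, logisticDensity_abs]

lemma isStationary_halfSpace_single (i : Fin (N + 1)) {ε : ℝ} (hε : |ε| = 1) (t : ℝ) :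
    IsStationary (logisticProdDensity (N + 1)) (halfSpace (EuclideanSpace.single i ε) t) := by
  have hv : ‖(EuclideanSpace.single i ε : Euc (N + 1))‖ = 1 := by simpa
  have hε0 : ε ≠ 0 := abs_ne_zero.1 (hε ▸ one_ne_zero)
  refine (isStationary_logistic_halfSpace_iff hv t).2 ⟨ε * score (t / ε), fun x hx => ?_⟩
  simp only [EuclideanSpace.inner_single_right, conj_trivial] at hx
  rw [eq_div_of_mul_eq hε0 ((mul_comm _ _).trans hx) |>.symm]
  simp

theorem isStable_of_isCoordinate {v : Euc (N + 1)} (hv : ‖v‖ = 1) (hc : IsCoordinate v) {t : ℝ}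
    (ht : logisticDensity t ≤ 1 / 8) :
    IsStable (logisticProdDensity (N + 1)) (halfSpace v t) := by
  obtain ⟨i, ε, hε, rfl⟩ := exists_eq_single_of_isCoordinate hv hc
  refine ((isHyperplaneChart_coordinateChart i hε).isStable_logistic_halfSpace_iff t).2
    ⟨isStationary_halfSpace_single i hε t, fun φ hφ hs hmean => ?_⟩
  have hsum (y : Euc N) : ∑ k, (EuclideanSpace.single i ε : Euc (N + 1)) k ^ 2 *
      logisticDensity ((insertNthIsometry i (WithLp.toLp 2 (t * ε, y))) k) =
        logisticDensity t := by
    rw [Finset.sum_eq_single i (fun k _ hk => by simp [hk]) (by simp),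
      insertNthIsometry_apply_same, WithLp.toLp_fst,
      logisticDensity_mul_of_abs_eq_one t hε]
    simp [← sq_abs ε, hε]
  simp only [smul_single_add_coordinateChart, logisticProdDensity_insertNthIsometry, hsum,
    WithLp.toLp_fst, WithLp.toLp_snd, logisticDensity_mul_of_abs_eq_one t hε, mul_assoc,
    integral_const_mul, ← integral_logisticProdMeasure] at hmean ⊢
  have hft := logisticDensity_pos t
  have hpoincare := satisfiesPoincare_logisticProdMeasure N φ (hφ.of_le (by simp)) hs
  rw [variance_of_integral_eq_zero hφ.continuous.aemeasurable
    ((mul_eq_zero.1 hmean).resolve_left hft.ne')] at hpoincare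
  have hdirichlet : 0 ≤ ∫ y, ‖fderiv ℝ φ y‖ ^ 2 ∂logisticProdMeasure N :=
    integral_nonneg fun y => sq_nonneg _
  set E := ∫ y, ‖fderiv ℝ φ y‖ ^ 2 ∂logisticProdMeasure N
  calc 2 * (logisticDensity t * (logisticDensity t * ∫ y, φ y ^ 2 ∂logisticProdMeasure N))
      ≤ 2 * (logisticDensity t * (1 / 8 * (4 * E))) := by gcongr
    _ = logisticDensity t * E := by ring

end Coordinate

/-! ### Stationary half-spaces -/

section Stationary

variable {N : ℕ} {v : Euc (N + 1)} {t : ℝ}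

lemma abs_eq_of_logisticDensity_eq {a b : ℝ} (h : logisticDensity a = logisticDensity b) :
    |a| = |b| := by
  simp only [logisticDensity_eq_score] at h
  rw [abs_eq_abs]
  rcases sq_eq_sq_iff_eq_or_eq_neg.1 (by linarith : score a ^ 2 = score b ^ 2) with h | h
  · exact .inl (score_strictMono.injective h)
  · exact .inr (score_strictMono.injective (h.trans (score_neg b).symm))

lemma inner_single_add_single {d : ℕ} (v : Euc d) (i j : Fin d) (a b : ℝ) :
    ⟪EuclideanSpace.single i a + EuclideanSpace.single j b, v⟫_ℝ = a * v i + b * v j := by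
  simp [inner_add_left, EuclideanSpace.inner_single_left]

lemma sum_mul_logisticDensity_mul_eq_zero (hv : ‖v‖ = 1)
    (hst : IsStationary (logisticProdDensity (N + 1)) (halfSpace v t)) {x w : Euc (N + 1)}
    (hx : ⟪x, v⟫_ℝ = t) (hw : ⟪w, v⟫_ℝ = 0) : ∑ k, v k * (logisticDensity (x k) * w k) = 0 := by
  obtain ⟨c, hc⟩ := (isStationary_logistic_halfSpace_iff hv t).1 hst
  have hconst (s : ℝ) : ∑ k, v k * score (x k + s * w k) = c := by
    simpa using hc (x + s • w) (by rw [inner_add_left, real_inner_smul_left, hw, hx]; ring)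
  have hderiv : HasDerivAt (fun s : ℝ => ∑ k, v k * score (x k + s * w k))
      (∑ k, v k * (2 * logisticDensity (x k + 0 * w k) * w k)) 0 :=
    .fun_sum fun k _ => .const_mul _ <| (hasDerivAt_score _).comp 0 <| by
      simpa using ((hasDerivAt_id' (0 : ℝ)).mul_const (w k)).const_add (x k)
  have hzero := hderiv.unique (funext hconst ▸ hasDerivAt_const (0 : ℝ) c)
  simp only [zero_mul, add_zero, mul_assoc, mul_left_comm _ (2 : ℝ), ← Finset.mul_sum] at hzero
  exact (mul_eq_zero.1 hzero).resolve_left two_ne_zero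

lemma abs_eq_of_isStationary (hv : ‖v‖ = 1)
    (hst : IsStationary (logisticProdDensity (N + 1)) (halfSpace v t)) {i j : Fin (N + 1)}
    (hi : v i ≠ 0) (hj : v j ≠ 0) {x : Euc (N + 1)} (hx : ⟪x, v⟫_ℝ = t) :
    |x i| = |x j| := by
  have hzero := sum_mul_logisticDensity_mul_eq_zero hv hst hx
    (w := EuclideanSpace.single i (v j) + EuclideanSpace.single j (-v i))
    (by rw [inner_single_add_single]; ring)
  have hfactor : v i * v j * (logisticDensity (x i) - logisticDensity (x j)) = 0 := by
    simp only [PiLp.add_apply, PiLp.single_apply, mul_add, mul_ite, mul_zero, mul_neg,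
      Finset.sum_add_distrib, Finset.sum_ite_eq', Finset.mem_univ, ↓reduceIte] at hzero
    linarith
  exact abs_eq_of_logisticDensity_eq
    (sub_eq_zero.1 ((mul_eq_zero.1 hfactor).resolve_left (mul_ne_zero hi hj)))

theorem eq_zero_and_mem_bisectorVectors_of_isStationary (hv : ‖v‖ = 1) (hnc : ¬ IsCoordinate v)
    (hst : IsStationary (logisticProdDensity (N + 1)) (halfSpace v t)) :
    t = 0 ∧ v ∈ bisectorVectors (N + 1) := by
  obtain ⟨i, hi⟩ : ∃ i, v i ≠ 0 := by
    contrapose! hnc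
    exact ⟨0, fun k _ => hnc k⟩
  obtain ⟨j, hji, hj⟩ : ∃ j, j ≠ i ∧ v j ≠ 0 := by
    contrapose! hnc
    exact ⟨i, hnc⟩
  have habs {x : Euc (N + 1)} (hx : ⟪x, v⟫_ℝ = t) : |x i| = |x j| :=
    abs_eq_of_isStationary hv hst hi hj hx
  obtain rfl : t = 0 := by
    have := habs (x := EuclideanSpace.single i 0 + EuclideanSpace.single j (t / v j))
      (by rw [inner_single_add_single]; field_simp; ring)
    simpa [hji, hji.symm, hj] using this.symm
  refine ⟨rfl, hv, i, j, hji.symm, fun k hki hkj => ?_, ?_, abs_ne_zero.2 hi⟩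
  · have := habs (x := EuclideanSpace.single j (v k) + EuclideanSpace.single k (-v j))
      (by rw [inner_single_add_single]; ring)
    simpa [hki.symm, hkj.symm, hji.symm] using this.symm
  · have := habs (x := EuclideanSpace.single i (v j) + EuclideanSpace.single j (-v i))
      (by rw [inner_single_add_single]; ring)
    simpa [hji, hji.symm] using this.symm

end Stationary

/-! ### Bisector half-spaces -/

section Bisector

variable {n : ℕ} (i : Fin (n + 2)) (m : Fin (n + 1))

/-- The point of `ℝⁿ⁺²` with `i`-th coordinate `a`, with `b` as the `m`-th of the other
coordinates, and with the coordinates of `z` at the remaining places. -/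
def insertPair (a b : ℝ) (z : Euc n) : Euc (n + 2) :=
  insertNthIsometry i (WithLp.toLp 2 (a, insertNthIsometry m (WithLp.toLp 2 (b, z))))

lemma sum_insertPair (g : ℝ → ℝ → ℝ) (a b a' b' : ℝ) (z z' : Euc n) :
    ∑ k, g (insertPair i m a b z k) (insertPair i m a' b' z' k) =
      g a a' + (g b b' + ∑ k, g (z k) (z' k)) := by
  simp [insertPair, insertNthIsometry, Fin.sum_univ_succAbove _ i, Fin.sum_univ_succAbove _ m]

lemma inner_insertPair (a b a' b' : ℝ) (z z' : Euc n) :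
    ⟪insertPair i m a b z, insertPair i m a' b' z'⟫_ℝ = a * a' + (b * b' + ⟪z, z'⟫_ℝ) := by
  simp only [PiLp.inner_apply, RCLike.inner_apply, conj_trivial]
  rw [sum_insertPair i m fun x y => y * x]
  ring

lemma logisticProdDensity_insertPair (a b : ℝ) (z : Euc n) :
    logisticProdDensity (n + 2) (insertPair i m a b z) =
      logisticDensity a * (logisticDensity b * logisticProdDensity n z) := by
  simp [insertPair, logisticProdDensity_insertNthIsometry]

lemma exists_eq_insertPair (x : Euc (n + 2)) : ∃ a b z, x = insertPair i m a b z := by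
  obtain ⟨p, rfl⟩ := (insertNthIsometry i).surjective x
  obtain ⟨q, hq⟩ := (insertNthIsometry m).surjective p.snd
  exact ⟨p.fst, q.fst, q.snd, congrArg _ (WithLp.ofLp_injective 2 (Prod.ext rfl hq.symm))⟩

lemma exists_eq_insertPair_of_mem_bisectorVectors {v : Euc (n + 2)}
    (hv : v ∈ bisectorVectors (n + 2)) :
    ∃ i m α β, α ^ 2 = 1 / 2 ∧ β ^ 2 = 1 / 2 ∧ v = insertPair i m α β 0 := by
  obtain ⟨hnorm, i, j, hij, hzero, habs, -⟩ := hv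
  obtain ⟨m, rfl⟩ := Fin.exists_succAbove_eq hij.symm
  obtain ⟨α, β, z, rfl⟩ := exists_eq_insertPair i m v
  obtain rfl : z = 0 := by
    ext k
    simpa [insertPair, insertNthIsometry] using
      hzero (i.succAbove (m.succAbove k)) (Fin.succAbove_ne i _) (by simp)
  have hsq : α ^ 2 = β ^ 2 := by
    simpa [insertPair, insertNthIsometry, sq_eq_sq_iff_abs_eq_abs] using habs
  have hsum : α * α + (β * β + ⟪(0 : Euc n), 0⟫_ℝ) = 1 := by
    rw [← inner_insertPair i m, real_inner_self_eq_norm_sq, hnorm, one_pow]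
  rw [inner_zero_left] at hsum
  exact ⟨i, m, α, β, by linarith, by linarith, rfl⟩

variable {i m} {α β : ℝ}

/-- The parametrization of the hyperplane orthogonal to `insertPair i m α β 0`. -/
def insertPairChart (i : Fin (n + 2)) (m : Fin (n + 1)) (h : α ^ 2 + β ^ 2 = 1) :
    WithLp 2 (ℝ × Euc n) →ₗᵢ[ℝ] Euc (n + 2) where
  toFun p := insertPair i m (-β * p.fst) (α * p.fst) p.snd
  map_add' p q := by
    ext k
    cases k using i.succAboveCases with
    | x =>
      simp only [insertPair, insertNthIsometry, WithLp.add_fst, neg_mul, WithLp.add_snd,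
        LinearIsometryEquiv.coe_mk, LinearEquiv.coe_mk, LinearMap.coe_mk, AddHom.coe_mk,
        WithLp.toLp_fst, WithLp.toLp_snd, WithLp.ofLp_add, Fin.insertNth_apply_same, PiLp.add_apply]
      ring
    | p k => cases k using m.succAboveCases <;> simp [insertPair, insertNthIsometry, mul_add]
  map_smul' c p := by
    ext k
    cases k using i.succAboveCases with
    | x =>
      simp only [insertPair, insertNthIsometry, WithLp.smul_fst, smul_eq_mul, neg_mul,
        WithLp.smul_snd, LinearIsometryEquiv.coe_mk, LinearEquiv.coe_mk, LinearMap.coe_mk,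
        AddHom.coe_mk, WithLp.toLp_fst, WithLp.toLp_snd, WithLp.ofLp_smul, Fin.insertNth_apply_same,
        Real.ringHom_apply, PiLp.smul_apply, mul_neg, neg_inj]
      ring
    | p k => cases k using m.succAboveCases <;> simp [insertPair, insertNthIsometry, mul_left_comm]
  norm_map' p := by
    rw [← sq_eq_sq₀ (norm_nonneg _) (norm_nonneg _), WithLp.prod_norm_sq_eq_of_L2]
    simp only [LinearMap.coe_mk, AddHom.coe_mk, insertPair, LinearIsometryEquiv.norm_map,
      WithLp.prod_norm_sq_eq_of_L2, WithLp.toLp_fst, WithLp.toLp_snd, Real.norm_eq_abs, sq_abs]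
    linear_combination p.fst ^ 2 * h

lemma isHyperplaneChart_insertPairChart (h : α ^ 2 + β ^ 2 = 1) :
    IsHyperplaneChart (insertPair i m α β 0) (insertPairChart i m h) where
  norm_eq_one := by
    rw [← sq_eq_sq₀ (norm_nonneg _) zero_le_one, ← real_inner_self_eq_norm_sq, inner_insertPair]
    simp [← sq, h]
  inner_eq_zero p := by
    simp only [insertPairChart, neg_mul, LinearIsometry.coe_mk, LinearMap.coe_mk, AddHom.coe_mk,
      inner_insertPair, inner_zero_right, add_zero]
    ring
  finrank_eq := by simp [(insertNthIsometry (0 : Fin (n + 1))).toLinearEquiv.finrank_eq]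

lemma isStationary_halfSpace_insertPair (hα : α ^ 2 = 1 / 2) (hβ : β ^ 2 = 1 / 2) :
    IsStationary (logisticProdDensity (n + 2)) (halfSpace (insertPair i m α β 0) 0) := by
  have hα0 : α ≠ 0 := by rintro rfl; norm_num at hα
  have hchart := isHyperplaneChart_insertPairChart (i := i) (m := m) (α := α) (β := β)
    (by rw [hα, hβ]; norm_num)
  refine (isStationary_logistic_halfSpace_iff hchart.norm_eq_one 0).2 ⟨0, fun x hx => ?_⟩
  obtain ⟨a, b, z, rfl⟩ := exists_eq_insertPair i m x
  rw [inner_insertPair, inner_zero_right] at hx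
  rw [sum_insertPair i m fun c x => c * score x]
  rcases sq_eq_sq_iff_eq_or_eq_neg.1 (hβ.trans hα.symm) with rfl | rfl
  · obtain rfl : a = -b := mul_right_cancel₀ hα0 (by linarith)
    simp [score_neg]
  · obtain rfl : a = b := mul_right_cancel₀ hα0 (by linarith)
    simp

lemma isStable_halfSpace_insertPair_iff (hα : α ^ 2 = 1 / 2) (hβ : β ^ 2 = 1 / 2) :
    IsStable (logisticProdDensity (n + 2)) (halfSpace (insertPair i m α β 0) 0) ↔
      ∀ φ : WithLp 2 (ℝ × Euc n) → ℝ, ContDiff ℝ ∞ φ → HasCompactSupport φ →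
        ∫ p, logisticDensity (α * p.fst) ^ 2 * logisticProdDensity n p.snd * φ p = 0 →
        2 * ∫ p, logisticDensity (α * p.fst) ^ 3 * logisticProdDensity n p.snd * φ p ^ 2 ≤
          ∫ p, logisticDensity (α * p.fst) ^ 2 * logisticProdDensity n p.snd *
            ‖fderiv ℝ φ p‖ ^ 2 := by
  have hchart := isHyperplaneChart_insertPairChart (i := i) (m := m) (α := α) (β := β)
    (by rw [hα, hβ]; norm_num)
  have hdensity (s : ℝ) : logisticDensity (-β * s) = logisticDensity (α * s) := by
    rw [← logisticDensity_abs, ← logisticDensity_abs (α * s), abs_mul, abs_mul, abs_neg,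
      (sq_eq_sq_iff_abs_eq_abs _ _).1 (hβ.trans hα.symm)]
  rw [hchart.isStable_logistic_halfSpace_iff 0,
    and_iff_right (isStationary_halfSpace_insertPair hα hβ)]
  have hweight (p : WithLp 2 (ℝ × Euc n)) :
      logisticProdDensity (n + 2) (insertPair i m (-β * p.fst) (α * p.fst) p.snd) =
        logisticDensity (α * p.fst) ^ 2 * logisticProdDensity n p.snd := by
    rw [logisticProdDensity_insertPair, hdensity, sq, mul_assoc]
  have hpotential (p : WithLp 2 (ℝ × Euc n)) :
      ∑ k, insertPair i m α β 0 k ^ 2 *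
        logisticDensity (insertPair i m (-β * p.fst) (α * p.fst) p.snd k) =
          logisticDensity (α * p.fst) := by
    rw [sum_insertPair i m fun c x => c ^ 2 * logisticDensity x, hdensity, hα, hβ]
    simp only [one_div, PiLp.zero_apply, ne_eq, OfNat.ofNat_ne_zero, not_false_eq_true, zero_pow,
      zero_mul, Finset.sum_const_zero, add_zero]
    ring
  have hcube (a b c : ℝ) : a ^ 2 * b * (a * c) = a ^ 3 * b * c := by ring
  simp only [zero_smul, zero_add, insertPairChart, LinearIsometry.coe_mk, LinearMap.coe_mk,
    AddHom.coe_mk, hweight, hpotential, hcube]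

end Bisector

section Plane

variable {α β : ℝ}

lemma two_mul_integral_logisticDensity_cube_mul_sq_le_deriv (hα : α ^ 2 = 1 / 2) {u : ℝ → ℝ}
    (hu : ContDiff ℝ 1 u) (hs : HasCompactSupport u)
    (h0 : ∫ s, logisticDensity (α * s) ^ 2 * u s = 0) :
    2 * ∫ s, logisticDensity (α * s) ^ 3 * u s ^ 2 ≤
      ∫ s, logisticDensity (α * s) ^ 2 * deriv u s ^ 2 := by
  have hα0 : α ≠ 0 := by rintro rfl; norm_num at hα
  have hscale (G : ℝ → ℝ → ℝ) :
      ∫ s, G (α * s) s = |α⁻¹| * ∫ x, G x (α⁻¹ * x) := by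
    simpa [inv_mul_cancel_left₀ hα0] using
      Measure.integral_comp_mul_left (fun x => G x (α⁻¹ * x)) α
  have hbound := four_mul_integral_logisticDensity_cube_mul_sq_le_deriv
    (u := fun x => u (α⁻¹ * x)) (by fun_prop)
    (hs.comp_homeomorph (Homeomorph.mulLeft₀ α⁻¹ (inv_ne_zero hα0)))
    ((mul_eq_zero.1 ((hscale fun x s => logisticDensity x ^ 2 * u s).symm.trans h0)).resolve_left
      (by positivity))
  simp only [deriv_comp_mul_left, smul_eq_mul, mul_pow, inv_pow, hα,
    mul_left_comm _ (1 / 2 : ℝ)⁻¹, integral_const_mul] at hbound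
  rw [hscale fun x s => logisticDensity x ^ 3 * u s ^ 2,
    hscale fun x s => logisticDensity x ^ 2 * deriv u s ^ 2, mul_left_comm]
  gcongr
  linarith

lemma isStable_halfSpace_insertPair (i : Fin 2) (m : Fin 1) (hα : α ^ 2 = 1 / 2)
    (hβ : β ^ 2 = 1 / 2) :
    IsStable (logisticProdDensity 2) (halfSpace (insertPair i m α β 0) 0) := by
  let e : ℝ ≃ₗᵢ[ℝ] WithLp 2 (ℝ × Euc 0) :=
    (LinearIsometryEquiv.withLpProdUnique 2 ℝ ℝ (Euc 0)).symm
  have hfst (s : ℝ) : (e s).fst = s := rfl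
  have hintegral (g : WithLp 2 (ℝ × Euc 0) → ℝ) : ∫ p, g p = ∫ s, g (e s) :=
    (e.measurePreserving.integral_comp e.toHomeomorph.measurableEmbedding g).symm
  refine (isStable_halfSpace_insertPair_iff hα hβ).2 fun φ hφ hs hmean => ?_
  simp only [hintegral, hfst, logisticProdDensity, Finset.univ_eq_empty, Finset.prod_empty,
    mul_one, ← norm_fderiv_comp_linearIsometryEquiv φ e, ← norm_deriv_eq_norm_fderiv,
    Real.norm_eq_abs, sq_abs] at hmean ⊢
  exact two_mul_integral_logisticDensity_cube_mul_sq_le_deriv hα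
    ((hφ.of_le (by simp)).comp e.contDiff) (hs.comp_homeomorph e.toHomeomorph) hmean

end Plane

section Truncation

variable {V : Type*} [NormedAddCommGroup V] [NormedSpace ℝ V] [FiniteDimensional ℝ V]
  {g : V → ℝ} {C D : ℝ}

/-- A smooth bump function equal to `1` on the unit ball. -/
def unitBump (V : Type*) [NormedAddCommGroup V] [NormedSpace ℝ V] [FiniteDimensional ℝ V] :
    ContDiffBump (0 : V) :=
  ⟨1, 2, one_pos, one_lt_two⟩

/-- The product of `g` with a smooth cutoff that equals `1` on the ball of radius `k + 1`. -/
def truncate (g : V → ℝ) (k : ℕ) (x : V) : ℝ := g x * unitBump V ((k + 1 : ℝ)⁻¹ • x)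

lemma contDiff_truncate {n : ℕ∞} (hg : ContDiff ℝ n g) (k : ℕ) : ContDiff ℝ n (truncate g k) :=
  hg.mul ((unitBump V).contDiff.comp (contDiff_const_smul _))

lemma hasCompactSupport_truncate (g : V → ℝ) (k : ℕ) : HasCompactSupport (truncate g k) :=
  ((unitBump V).hasCompactSupport.comp_smul (by positivity)).mul_left

lemma odd_truncate (hodd : g.Odd) (k : ℕ) : (truncate g k).Odd := fun x => by
  simp only [truncate, hodd x, smul_neg, ContDiffBump.neg, neg_mul]

lemma abs_truncate_le (hC : ∀ x, |g x| ≤ C) (k : ℕ) (x : V) : |truncate g k x| ≤ C := by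
  rw [truncate, abs_mul, abs_of_nonneg (unitBump V).nonneg]
  exact (mul_le_of_le_one_right (abs_nonneg _) (unitBump V).le_one).trans (hC x)

lemma eventually_truncate_eventuallyEq (g : V → ℝ) (x : V) :
    ∀ᶠ k : ℕ in atTop, truncate g k =ᶠ[𝓝 x] g := by
  have hlim : Tendsto (fun k : ℕ => (k + 1 : ℝ)⁻¹ • x) atTop (𝓝 0) := by
    simpa using (tendsto_one_div_add_atTop_nhds_zero_nat (𝕜 := ℝ)).smul_const x
  filter_upwards [hlim (Metric.ball_mem_nhds 0 one_pos)] with k hk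
  filter_upwards [(continuous_const_smul (k + 1 : ℝ)⁻¹).continuousAt.eventually
    ((unitBump V).eventuallyEq_one_of_mem_ball hk)] with z hz
  rw [truncate, hz, Pi.one_apply, mul_one]

lemma exists_norm_fderiv_truncate_le (hg : ContDiff ℝ 1 g) (hC : ∀ x, |g x| ≤ C)
    (hD : ∀ x, ‖fderiv ℝ g x‖ ≤ D) : ∃ K, ∀ k x, ‖fderiv ℝ (truncate g k) x‖ ≤ K := by
  have hbump : ContDiff ℝ 1 (unitBump V) := (unitBump V).contDiff
  obtain ⟨B, hB⟩ := ((unitBump V).hasCompactSupport.fderiv ℝ).exists_bound_of_continuous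
    (hbump.continuous_fderiv one_ne_zero)
  refine ⟨C * B + D, fun k x => ?_⟩
  have hc : ‖(k + 1 : ℝ)⁻¹‖ ≤ 1 := by
    rw [norm_inv, Real.norm_of_nonneg (by positivity)]
    exact inv_le_one_of_one_le₀ (by simp)
  have hC0 : 0 ≤ C := (abs_nonneg _).trans (hC 0)
  have hcutoff : ‖fderiv ℝ (fun z : V => unitBump V ((k + 1 : ℝ)⁻¹ • z)) x‖ ≤ B := by
    rw [fderiv_comp_smul, norm_smul]
    exact (mul_le_of_le_one_left (norm_nonneg _) hc).trans (hB _)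
  have hderiv : fderiv ℝ (truncate g k) x = _ := fderiv_fun_mul
    (hg.differentiable one_ne_zero x)
    ((hbump.comp (contDiff_const_smul _)).differentiable one_ne_zero x)
  rw [hderiv]
  refine (norm_add_le _ _).trans ?_
  rw [norm_smul, norm_smul, Real.norm_eq_abs, Real.norm_of_nonneg (unitBump V).nonneg]
  gcongr
  · exact hC x
  · exact (mul_le_of_le_one_left (norm_nonneg _) (unitBump V).le_one).trans (hD x)

lemma tendsto_integral_mul_of_eventually_eq {X : Type*} [MeasurableSpace X] {μ : Measure X}
    {w : X → ℝ} (hw : Integrable w μ) {G : ℕ → X → ℝ} {H : X → ℝ} {K : ℝ}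
    (hG : ∀ k, AEStronglyMeasurable (G k) μ) (hK : ∀ k x, |G k x| ≤ K)
    (heq : ∀ x, ∀ᶠ k in atTop, G k x = H x) :
    Tendsto (fun k => ∫ x, w x * G k x ∂μ) atTop (𝓝 (∫ x, w x * H x ∂μ)) := by
  refine tendsto_integral_of_dominated_convergence (fun x => ‖w x‖ * K)
    (fun k => hw.aestronglyMeasurable.mul (hG k)) (hw.norm.mul_const K)
    (fun k => ae_of_all _ fun x => ?_) (ae_of_all _ fun x => ?_)
  · rw [norm_mul]
    exact mul_le_mul_of_nonneg_left (hK k x) (norm_nonneg _)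
  · exact tendsto_const_nhds.congr' ((heq x).mono fun k hk => by simp only [hk])

lemma integral_mul_sq_le_of_forall_hasCompactSupport [MeasurableSpace V] [BorelSpace V]
    {μ : Measure V} {w₁ w₂ : V → ℝ} (hw₁ : Integrable w₁ μ) (hw₂ : Integrable w₂ μ)
    (hle : ∀ φ : V → ℝ, ContDiff ℝ ∞ φ → HasCompactSupport φ → φ.Odd →
      ∫ x, w₁ x * φ x ^ 2 ∂μ ≤ ∫ x, w₂ x * ‖fderiv ℝ φ x‖ ^ 2 ∂μ)
    (hg : ContDiff ℝ ∞ g) (hodd : g.Odd) (hC : ∀ x, |g x| ≤ C) (hD : ∀ x, ‖fderiv ℝ g x‖ ≤ D) :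
    ∫ x, w₁ x * g x ^ 2 ∂μ ≤ ∫ x, w₂ x * ‖fderiv ℝ g x‖ ^ 2 ∂μ := by
  have hcont (k : ℕ) : ContDiff ℝ 1 (truncate g k) := contDiff_truncate (hg.of_le (by simp)) k
  obtain ⟨K, hK⟩ := exists_norm_fderiv_truncate_le (hg.of_le (by simp)) hC hD
  refine le_of_tendsto_of_tendsto'
    (tendsto_integral_mul_of_eventually_eq hw₁ (G := fun k x => truncate g k x ^ 2) (K := C ^ 2)
      (fun k => ((hcont k).continuous.pow 2).aestronglyMeasurable) (fun k x => ?_) fun x => ?_)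
    (tendsto_integral_mul_of_eventually_eq hw₂
      (G := fun k x => ‖fderiv ℝ (truncate g k) x‖ ^ 2) (K := K ^ 2)
      (fun k => (((hcont k).continuous_fderiv one_ne_zero).norm.pow 2).aestronglyMeasurable)
      (fun k x => ?_) fun x => ?_)
    fun k => hle _ (contDiff_truncate hg k) (hasCompactSupport_truncate g k) (odd_truncate hodd k)
  · rw [abs_pow]
    exact pow_le_pow_left₀ (abs_nonneg _) (abs_truncate_le hC k x) 2
  · exact (eventually_truncate_eventuallyEq g x).mono fun k hk => by rw [hk.self_of_nhds]
  · rw [abs_of_nonneg (sq_nonneg _)]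
    exact pow_le_pow_left₀ (norm_nonneg _) (hK k x) 2
  · exact (eventually_truncate_eventuallyEq g x).mono fun k hk => by rw [hk.fderiv_eq]

end Truncation

section OddTestFunction

/-- The odd function of the logistic line whose dependence on a third coordinate destabilizes
bisector half-spaces. The score alone would only give equality in the stability inequality, hence
the cubic term. -/
def cubicScore (x : ℝ) : ℝ := score x + score x ^ 3

lemma deriv_cubicScore (x : ℝ) :
    deriv cubicScore x = 2 * logisticDensity x * (1 + 3 * score x ^ 2) := by
  refine (((hasDerivAt_score x).fun_add ((hasDerivAt_score x).fun_pow 3)).congr_deriv ?_).deriv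
  push_cast
  ring

lemma contDiff_cubicScore {n : ℕ∞} : ContDiff ℝ n cubicScore :=
  contDiff_score.add (contDiff_score.pow 3)

lemma odd_cubicScore : cubicScore.Odd := fun x => by
  rw [cubicScore, cubicScore, score_neg]
  ring

lemma abs_cubicScore_le (x : ℝ) : |cubicScore x| ≤ 2 := by
  have hscore := abs_score_le_one x
  calc |cubicScore x| ≤ |score x| + |score x| ^ 3 := (abs_add_le _ _).trans_eq (by rw [abs_pow])
    _ ≤ 1 + 1 := add_le_add hscore (pow_le_one₀ (abs_nonneg _) hscore)
    _ = 2 := one_add_one_eq_two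

lemma abs_deriv_cubicScore_le (x : ℝ) : |deriv cubicScore x| ≤ 2 := by
  have hpos := logisticDensity_pos x
  have hle := logisticDensity_le_one_fourth x
  have hscore : score x ^ 2 ≤ 1 := (sq_le_one_iff_abs_le_one _).2 (abs_score_le_one x)
  rw [deriv_cubicScore, abs_of_nonneg (by positivity)]
  calc 2 * logisticDensity x * (1 + 3 * score x ^ 2) ≤ 2 * (1 / 4) * (1 + 3 * 1) := by gcongr
    _ = 2 := by norm_num

open Polynomial in
lemma integral_logisticDensity_mul_cubicScore_sq :
    ∫ x, logisticDensity x * cubicScore x ^ 2 = 92 / 105 := by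
  convert integral_logisticDensity_mul_eval_derivative_score
    (C (1 / 105) * (35 * X ^ 3 + 42 * X ^ 5 + 15 * X ^ 7)) using 1
  · congr 1 with x
    simp only [cubicScore, one_div, derivative_mul, derivative_C, zero_mul,
      derivative_ofNat, derivative_X_pow_succ, Nat.cast_ofNat, map_add, map_one, zero_add, eval_mul,
      eval_C, eval_add, eval_ofNat, eval_one, eval_pow, eval_X]
    ring
  · norm_num

open Polynomial in
lemma integral_logisticDensity_mul_deriv_cubicScore_sq :
    ∫ x, logisticDensity x * deriv cubicScore x ^ 2 = 32 / 105 := by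
  convert integral_logisticDensity_mul_eval_derivative_score
    (C (1 / 420) * (105 * X + 140 * X ^ 3 - 42 * X ^ 5 - 180 * X ^ 7 + 105 * X ^ 9)) using 1
  · congr 1 with x
    simp only [logisticDensity_eq_score, deriv_cubicScore, one_div, derivative_mul, derivative_C,
      zero_mul, derivative_sub, derivative_ofNat, derivative_X, mul_one, zero_add,
      derivative_X_pow_succ, Nat.cast_ofNat, map_add, map_one, eval_mul, eval_C, eval_add, eval_sub,
      eval_ofNat, eval_one, eval_pow, eval_X]
    ring
  · norm_num

lemma norm_fderiv_comp_inner {V : Type*} [NormedAddCommGroup V] [InnerProductSpace ℝ V]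
    {g : ℝ → ℝ} {e x : V} (hg : DifferentiableAt ℝ g ⟪e, x⟫_ℝ) :
    ‖fderiv ℝ (fun y => g ⟪e, y⟫_ℝ) x‖ = |deriv g ⟪e, x⟫_ℝ| * ‖e‖ := by
  have hderiv : HasFDerivAt (fun y => g ⟪e, y⟫_ℝ) (deriv g ⟪e, x⟫_ℝ • innerSL ℝ e) x :=
    hg.hasDerivAt.comp_hasFDerivAt x (innerSL ℝ e).hasFDerivAt
  rw [hderiv.fderiv, norm_smul, innerSL_apply_norm, Real.norm_eq_abs]

lemma inner_toLp_single {n : ℕ} (k : Fin n) (p : WithLp 2 (ℝ × Euc n)) :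
    ⟪WithLp.toLp 2 (0, EuclideanSpace.single k 1), p⟫_ℝ = p.snd k := by
  simp [WithLp.prod_inner_apply, EuclideanSpace.inner_single_left]

lemma contDiff_cubicScore_snd_apply {n : ℕ} (k : Fin n) {r : ℕ∞} :
    ContDiff ℝ r fun p : WithLp 2 (ℝ × Euc n) => cubicScore (p.snd k) := by
  simp only [← inner_toLp_single]
  exact contDiff_cubicScore.comp (innerSL ℝ _).contDiff

lemma norm_fderiv_cubicScore_snd_apply {n : ℕ} (k : Fin n) (p : WithLp 2 (ℝ × Euc n)) :
    ‖fderiv ℝ (fun q : WithLp 2 (ℝ × Euc n) => cubicScore (q.snd k)) p‖ =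
      |deriv cubicScore (p.snd k)| := by
  simp only [← inner_toLp_single]
  rw [norm_fderiv_comp_inner ((contDiff_cubicScore (n := 1)).differentiable one_ne_zero _)]
  simp

end OddTestFunction

section ProductIntegrals

variable {n : ℕ}

lemma integrable_logisticProdDensity (n : ℕ) : Integrable (logisticProdDensity n) :=
  integrable_of_integral_eq_one <| by
    simpa using (integral_logisticProdMeasure (d := n) fun _ => 1).symm

lemma integrable_mul_logisticProdDensity {a : ℝ → ℝ} (ha : Integrable a) :
    Integrable fun p : WithLp 2 (ℝ × Euc n) => a p.fst * logisticProdDensity n p.snd :=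
  ((WithLp.volume_preserving_toLp ℝ (Euc n)).integrable_comp_emb
    (MeasurableEquiv.toLp 2 (ℝ × Euc n)).measurableEmbedding).1
      (ha.mul_prod (integrable_logisticProdDensity n))

lemma integral_mul_logisticProdDensity_mul (a : ℝ → ℝ) (b : Euc n → ℝ) :
    ∫ p : WithLp 2 (ℝ × Euc n), a p.fst * logisticProdDensity n p.snd * b p.snd =
      (∫ s, a s) * ∫ z, b z ∂logisticProdMeasure n := by
  rw [← (WithLp.volume_preserving_toLp ℝ (Euc n)).integral_comp
    (MeasurableEquiv.toLp 2 (ℝ × Euc n)).measurableEmbedding, integral_logisticProdMeasure,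
    ← integral_prod_mul a]
  simp only [WithLp.toLp_fst, WithLp.toLp_snd, mul_assoc]
  rfl

lemma integral_comp_apply_logisticProdMeasure (i : Fin (n + 1)) (g : ℝ → ℝ) :
    ∫ z, g (z i) ∂logisticProdMeasure (n + 1) = ∫ s, logisticDensity s * g s := by
  have hinsert : MeasurableEmbedding (insertNthIsometry i) :=
    (insertNthIsometry i).toHomeomorph.measurableEmbedding
  have htoLp : MeasurableEmbedding (WithLp.toLp 2 : ℝ × Euc n → WithLp 2 (ℝ × Euc n)) :=
    (MeasurableEquiv.toLp 2 (ℝ × Euc n)).measurableEmbedding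
  rw [logisticProdMeasure_succ n i, hinsert.integral_map, htoLp.integral_map]
  simp only [insertNthIsometry_apply_same, WithLp.toLp_fst]
  rw [integral_fun_fst, probReal_univ, one_smul, logisticMeasure,
    integral_withDensity_ofReal continuous_logisticDensity.measurable
      fun s => (logisticDensity_pos s).le]

end ProductIntegrals

section BisectorStability

variable {n : ℕ} {α β : ℝ}

lemma logisticProdDensity_neg {d : ℕ} (x : Euc d) :
    logisticProdDensity d (-x) = logisticProdDensity d x := by
  simp [logisticProdDensity, logisticDensity_neg]

lemma integrable_logisticDensity_const_mul_pow (hα : α ≠ 0) (k : ℕ) :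
    Integrable fun s => logisticDensity (α * s) ^ (k + 1) :=
  (integrable_comp_mul_left_iff (fun s => logisticDensity s ^ (k + 1)) hα).2
    (integrable_logisticDensity_pow k)

lemma integral_logisticDensity_mul_eq_zero_of_odd {φ : WithLp 2 (ℝ × Euc n) → ℝ} (hφ : φ.Odd) :
    ∫ p, logisticDensity (α * p.fst) ^ 2 * logisticProdDensity n p.snd * φ p = 0 := by
  have hneg := integral_neg_eq_self (fun p : WithLp 2 (ℝ × Euc n) =>
    logisticDensity (α * p.fst) ^ 2 * logisticProdDensity n p.snd * φ p) volume
  simp only [WithLp.neg_fst, WithLp.neg_snd, mul_neg, logisticDensity_neg,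
    logisticProdDensity_neg, hφ _, integral_neg] at hneg
  linarith

lemma integral_mul_cubicScore_sq_le_of_isStable {i : Fin (n + 2)} {m : Fin (n + 1)}
    (hα : α ^ 2 = 1 / 2) (hβ : β ^ 2 = 1 / 2)
    (hstable : IsStable (logisticProdDensity (n + 2)) (halfSpace (insertPair i m α β 0) 0))
    (k : Fin n) :
    2 * ∫ p : WithLp 2 (ℝ × Euc n),
        logisticDensity (α * p.fst) ^ 3 * logisticProdDensity n p.snd * cubicScore (p.snd k) ^ 2 ≤
      ∫ p : WithLp 2 (ℝ × Euc n),
        logisticDensity (α * p.fst) ^ 2 * logisticProdDensity n p.snd *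
          deriv cubicScore (p.snd k) ^ 2 := by
  have hα0 : α ≠ 0 := by rintro rfl; norm_num at hα
  have hquadratic := integral_mul_sq_le_of_forall_hasCompactSupport
    ((integrable_mul_logisticProdDensity
      (integrable_logisticDensity_const_mul_pow hα0 2)).const_mul 2)
    (integrable_mul_logisticProdDensity (integrable_logisticDensity_const_mul_pow hα0 1))
    (fun φ hφ hs hodd => by
      simpa only [mul_assoc (2 : ℝ), integral_const_mul] using
        (isStable_halfSpace_insertPair_iff hα hβ).1 hstable φ hφ hs
          (integral_logisticDensity_mul_eq_zero_of_odd hodd))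
    (contDiff_cubicScore_snd_apply k) (fun p => odd_cubicScore _) (fun p => abs_cubicScore_le _)
    (fun p => (norm_fderiv_cubicScore_snd_apply k p).trans_le (abs_deriv_cubicScore_le _))
  simpa only [norm_fderiv_cubicScore_snd_apply, sq_abs, mul_assoc (2 : ℝ), integral_const_mul]
    using hquadratic

lemma not_isStable_halfSpace_insertPair (i : Fin (n + 3)) (m : Fin (n + 2)) (hα : α ^ 2 = 1 / 2)
    (hβ : β ^ 2 = 1 / 2) :
    ¬ IsStable (logisticProdDensity (n + 3)) (halfSpace (insertPair i m α β 0) 0) := by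
  intro hstable
  have hα0 : α ≠ 0 := by rintro rfl; norm_num at hα
  have hquadratic := integral_mul_cubicScore_sq_le_of_isStable hα hβ hstable 0
  rw [integral_mul_logisticProdDensity_mul (fun s => logisticDensity (α * s) ^ 3)
      fun z => cubicScore (z 0) ^ 2,
    integral_mul_logisticProdDensity_mul (fun s => logisticDensity (α * s) ^ 2)
      fun z => deriv cubicScore (z 0) ^ 2,
    integral_comp_apply_logisticProdMeasure 0 fun s => cubicScore s ^ 2,
    integral_comp_apply_logisticProdMeasure 0 fun s => deriv cubicScore s ^ 2,
    integral_logisticDensity_mul_cubicScore_sq, integral_logisticDensity_mul_deriv_cubicScore_sq,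
    Measure.integral_comp_mul_left fun s => logisticDensity s ^ 3,
    Measure.integral_comp_mul_left fun s => logisticDensity s ^ 2,
    integral_logisticDensity_cube, integral_logisticDensity_sq, smul_eq_mul, smul_eq_mul]
    at hquadratic
  have hscale : 0 < |α⁻¹| := by positivity
  linarith

theorem isStable_halfSpace_zero_iff {v : Euc (n + 2)} (hv : v ∈ bisectorVectors (n + 2)) :
    IsStable (logisticProdDensity (n + 2)) (halfSpace v 0) ↔ n = 0 := by
  obtain ⟨i, m, α, β, hα, hβ, rfl⟩ := exists_eq_insertPair_of_mem_bisectorVectors hv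
  cases n with
  | zero => simpa using isStable_halfSpace_insertPair i m hα hβ
  | succ n => simpa using not_isStable_halfSpace_insertPair i m hα hβ

end BisectorStability

end HalfSpaceStability

end

theorem mainTheorem8_general (N : ℕ) (v : HalfSpaceStability.Euc (N + 1)) (hv : ‖v‖ = 1) (t : ℝ) :
    (HalfSpaceStability.IsCoordinate v → 2 * Real.log (1 + √2) ≤ |t| →
      HalfSpaceStability.IsStable (HalfSpaceStability.logisticProdDensity (N + 1))
        (HalfSpaceStability.halfSpace v t)) ∧
    (¬ HalfSpaceStability.IsCoordinate v →
      (HalfSpaceStability.IsStable (HalfSpaceStability.logisticProdDensity (N + 1))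
          (HalfSpaceStability.halfSpace v t) ↔
        N + 1 = 2 ∧ t = 0 ∧ v ∈ HalfSpaceStability.bisectorVectors (N + 1))) := by
  refine ⟨fun hc ht => HalfSpaceStability.isStable_of_isCoordinate hv hc
    (HalfSpaceStability.logisticDensity_le_one_eighth ht), fun hnc => ⟨fun hst => ?_, ?_⟩⟩
  · obtain ⟨rfl, hb⟩ :=
      HalfSpaceStability.eq_zero_and_mem_bisectorVectors_of_isStationary hv hnc hst.1
    obtain _ | n := N
    · exact absurd ⟨0, fun k hk => absurd (Fin.fin_one_eq_zero k) hk⟩ hnc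
    · obtain rfl := (HalfSpaceStability.isStable_halfSpace_zero_iff hb).1 hst
      exact ⟨rfl, rfl, hb⟩
  · rintro ⟨hN, rfl, hb⟩
    obtain rfl : N = 1 := by omega
    exact (HalfSpaceStability.isStable_halfSpace_zero_iff hb).2 rfl

theorem mainTheorem8 (N : ℕ) (v : HalfSpaceStability.Euc (N + 1)) (hv : ‖v‖ = 1) (t : ℝ) :
    (HalfSpaceStability.IsCoordinate v → 2 * Real.log (2 + √3) ≤ |t| →
      HalfSpaceStability.IsStable (HalfSpaceStability.logisticProdDensity (N + 1))
        (HalfSpaceStability.halfSpace v t)) ∧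
    (¬ HalfSpaceStability.IsCoordinate v →
      (HalfSpaceStability.IsStable (HalfSpaceStability.logisticProdDensity (N + 1))
          (HalfSpaceStability.halfSpace v t) ↔
        N + 1 = 2 ∧ t = 0 ∧ v ∈ HalfSpaceStability.bisectorVectors (N + 1))) := by
  have hlog : Real.log (1 + √2) ≤ Real.log (2 + √3) := by gcongr <;> norm_num
  have hgeneral := mainTheorem8_general N v hv t
  exact ⟨fun hc ht => hgeneral.1 hc ((mul_le_mul_of_nonneg_left hlog zero_le_two).trans ht),
    hgeneral.2⟩
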